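/- Let $K$ be an algebraically closed field of characteristic zero, let $T\cong (K^*)^r$ be a torus over $K$ with Lie algebra $\mathfrak t$, and let $V$ be a (rational) representation of $T$ of finite dimension $n$. Choose a basis of $V$ consisting of weight vectors, so that $t\in T$ acts on the coordinates by $(v_i)_i\mapsto\big(\prod_{j=1}^r t_j^{s_i^j}\,v_i\big)_i$ with $s_i=(s_i^j)_j\in\mathbb Z^r$, and let $S=(s_i^j)_{i,j}$ be the $n\times r$ weight matrix. For $I\subseteq\{1,\dots,n\}$ let $S_I$ be the submatrix of $S$ formed by the rows indexed by $I$, let $S_{\hat\imath}=S_{\{1,\dots,n\}\setminus\{i\}}$, and let $J_I=\{v\in V\mid v_i\neq 0\Leftrightarrow i\in I\}$. Let $\mu:V\oplus V^*\to\mathfrak t^*$, $\mu(x,\varphi)(g)=\varphi(g\cdot x)$, be the moment map, let $\mu^{-1}(0)$ be its scheme-theoretic zero fibre, and let $\mu^{-1}(0)_{J_I}=\{(x,\varphi)\in\mu^{-1}(0)\mid x\in J_I\}$. Then: (i) $\mu^{-1}(0)$ is a reduced complete intersection (its ideal in the coordinate ring of $V\oplus V^*$ is generated by as many elements as its codimension)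 of dimension $2\dim V-\operatorname{rk}S$. (ii) The irreducible components of $\mu^{-1}(0)$ are exactly the closures $\overline{\mu^{-1}(0)_{J_I}}$, for the subsets $I\subseteq\{1,\dots,n\}$ with $\operatorname{rk}S-\operatorname{rk}S_I=n-\#I$. (iii) $\mu^{-1}(0)$ is irreducible if and only if $\operatorname{rk}S_{\hat\imath}=\operatorname{rk}S$ for every $i\in\{1,\dots,n\}$. (iv) $\mu^{-1}(0)$ is normal if and only if it is irreducible. -/

import Mathlib

open scoped TensorProduct

/-- A rational representation on the `K`-vector space `V` of the affine algebraic group `Spec A`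
over `K`, given as a (right) comodule over the coordinate ring `A`: the coaction `V → V ⊗ A`
sends `v` to the map `t ↦ t • v`, seen as an element of `V ⊗ A`. -/
structure RationalRep (K A V : Type*) [Field K] [CommRing A] [HopfAlgebra K A]
    [AddCommGroup V] [Module K V] where
  coact : V →ₗ[K] V ⊗[K] A
  coassoc : ∀ v, TensorProduct.assoc K V A A (coact.rTensor A (coact v)) =
    (Coalgebra.comul (R := K) (A := A)).lTensor V (coact v)
  counit : ∀ v, (Coalgebra.counit (R := K) (A := A)).lTensor V (coact v) = v ⊗ₜ[K] (1 : K)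

/-- The Lie algebra (as a vector space) of `Spec A`: the tangent space at the identity, that is the
linear forms on `A` which are derivations at the counit. -/
def lieSpace (K A : Type*) [Field K] [CommRing A] [HopfAlgebra K A] :
    Submodule K (Module.Dual K A) where
  carrier := {D | ∀ f g : A, D (f * g) =
    Coalgebra.counit (R := K) f * D g + D f * Coalgebra.counit (R := K) g}
  add_mem' := by
    intro D E hD hE f g
    simp only [Set.mem_ofPred_eq] at hD hE
    simp only [LinearMap.add_apply, hD f g, hE f g]
    ring
  zero_mem' := by
    intro f g
    simp
  smul_mem' := by
    intro c D hD f g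
    simp only [Set.mem_ofPred_eq] at hD
    simp only [LinearMap.smul_apply, hD f g, smul_eq_mul]
    ring

/-- The rank of the matrix `S_I` made of the rows of `S` indexed by `I`, as the matrix of a linear
map over `K` (in characteristic zero this is its rank over `ℚ`). -/
noncomputable def rowRank (K : Type*) [Field K] {n r : ℕ} (S : Matrix (Fin n) (Fin r) ℤ)
    (I : Finset (Fin n)) : ℕ :=
  ((S.map (Int.cast : ℤ → K)).submatrix (Subtype.val : I → Fin n) id).rank

/-- The closed subscheme of the affine space with coordinates `σ` cut out by `I` is a complete
intersection: `I` is generated by as many polynomials as the codimension of the subscheme. -/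
def IsCompleteIntersectionIdeal {K σ : Type*} [Field K] [Fintype σ]
    (I : Ideal (MvPolynomial σ K)) : Prop :=
  ∃ (c : ℕ) (f : Fin c → MvPolynomial σ K), I = Ideal.span (Set.range f) ∧
    ringKrullDim (MvPolynomial σ K ⧸ I) + (c : WithBot ℕ∞) = (Fintype.card σ : WithBot ℕ∞)

/-- A ring is normal if all its localizations at primes are integrally closed domains. -/
def IsNormalRing (R : Type*) [CommRing R] : Prop :=
  ∀ (P : Ideal R) [P.IsPrime], IsDomain (Localization.AtPrime P) ∧
    IsIntegrallyClosed (Localization.AtPrime P)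

namespace RationalRep

variable {K A V : Type*} [Field K] [CommRing A] [HopfAlgebra K A] [AddCommGroup V] [Module K V]

/-- The action on `V` of a `K`-point `t : A →ₐ[K] K` of the group. -/
noncomputable def act (ρ : RationalRep K A V) (t : A →ₐ[K] K) : V →ₗ[K] V :=
  (TensorProduct.rid K V).toLinearMap ∘ₗ t.toLinearMap.lTensor V ∘ₗ ρ.coact

/-- The differential of the representation: the action on `V` of an element of the Lie algebra. -/
noncomputable def lieAct (ρ : RationalRep K A V) (D : lieSpace K A) : V →ₗ[K] V :=
  (TensorProduct.rid K V).toLinearMap ∘ₗ (D : Module.Dual K A).lTensor V ∘ₗ ρ.coact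

/-- The moment map `V ⊕ V* → 𝔤*`, `(x, φ) ↦ (g ↦ φ (g • x))`. -/
noncomputable def momentMap (ρ : RationalRep K A V) (p : V × Module.Dual K V) :
    Module.Dual K (lieSpace K A) where
  toFun D := p.2 (ρ.lieAct D p.1)
  map_add' D E := by
    simp [lieAct, LinearMap.lTensor_add]
  map_smul' c D := by
    simp [lieAct, LinearMap.lTensor_smul]

/-- `b` is a basis of weight vectors of the representation of the torus `Spec A` and `b i` has
weight `s_i`, the `i`-th row of `S`; here the isomorphism `e` identifies the torus with `𝔾ₘ ^ r`,
hence its characters with `ℤ ^ r`. -/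
def IsWeightBasis {n r : ℕ} (ρ : RationalRep K A V)
    (e : A ≃ₐc[K] AddMonoidAlgebra K (Fin r → ℤ))
    (b : Module.Basis (Fin n) K V) (S : Matrix (Fin n) (Fin r) ℤ) : Prop :=
  ∀ i, ρ.coact (b i) = b i ⊗ₜ[K] e.symm (AddMonoidAlgebra.single (S i) 1)

/-- In a weight basis, a `K`-point `t` of the torus, with coordinates `t_j`, acts by
`t • b_i = (∏ j, t_j ^ (s_i)_j) b_i`. -/
theorem IsWeightBasis.act_apply {n r : ℕ} {ρ : RationalRep K A V}
    {e : A ≃ₐc[K] AddMonoidAlgebra K (Fin r → ℤ)}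
    {b : Module.Basis (Fin n) K V} {S : Matrix (Fin n) (Fin r) ℤ} (h : ρ.IsWeightBasis e b S)
    (t : A →ₐ[K] K) (i : Fin n) :
    ρ.act t (b i) =
      (∏ j, t (e.symm (AddMonoidAlgebra.single (Pi.single j 1) 1)) ^ S i j) • b i := by
  classical
  let χ : Multiplicative (Fin r → ℤ) →* K :=
    { toFun := fun m => t (e.symm (AddMonoidAlgebra.single m.toAdd 1))
      map_one' := by
        have : (AddMonoidAlgebra.single (0 : Fin r → ℤ) (1 : K)) = 1 := rfl
        simp [this]
      map_mul' := fun m m' => by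
        rw [← map_mul, ← map_mul, AddMonoidAlgebra.single_mul_single]
        simp }
  have key : t (e.symm (AddMonoidAlgebra.single (S i) 1)) =
      ∏ j, t (e.symm (AddMonoidAlgebra.single (Pi.single j 1) 1)) ^ S i j := by
    have h1 : Multiplicative.ofAdd (S i) =
        ∏ j, (Multiplicative.ofAdd (Pi.single j (1 : ℤ) : Fin r → ℤ)) ^ S i j := by
      apply Multiplicative.toAdd.injective
      rw [toAdd_prod]
      funext k
      simp [Finset.sum_apply, Pi.single_apply]
    have h2 : χ (Multiplicative.ofAdd (S i)) =
        ∏ j, χ (Multiplicative.ofAdd (Pi.single j (1 : ℤ) : Fin r → ℤ)) ^ S i j := by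
      rw [h1, map_prod]
      refine Finset.prod_congr rfl fun j _ => ?_
      exact map_zpow' χ (fun x => by
        refine eq_inv_of_mul_eq_one_left ?_
        rw [← map_mul, inv_mul_cancel, map_one]) _ _
    exact h2
  rw [← key]
  simp [act, h i]

/-- Every finite dimensional rational representation of a torus has a basis of weight vectors. -/
theorem exists_isWeightBasis [FiniteDimensional K V] {r : ℕ} (ρ : RationalRep K A V)
    (e : A ≃ₐc[K] AddMonoidAlgebra K (Fin r → ℤ)) :
    ∃ (b : Module.Basis (Fin (Module.finrank K V)) K V)
      (S : Matrix (Fin (Module.finrank K V)) (Fin r) ℤ), ρ.IsWeightBasis e b S := by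
  classical
  let M := Fin r → ℤ
  let g : M → A := fun m => e.symm (AddMonoidAlgebra.single m 1)
  let W : Set V := {v | ∃ m, ρ.coact v = v ⊗ₜ[K] g m}
  have hspan : ⊤ ≤ Submodule.span K W := by
    intro v _
    -- the coaction in terms of the basis of characters
    let B : Module.Basis M K A :=
      (Module.Basis.ofRepr (AddMonoidAlgebra.coeffLinearEquiv K)).map
        (e.symm.toLinearEquiv : AddMonoidAlgebra K M ≃ₗ[K] A)
    have hB : ∀ m, B m = g m := by
      intro m
      rfl
    have hcom : ∀ m, Coalgebra.comul (R := K) (g m) = g m ⊗ₜ[K] g m := by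
      intro m
      have h := CoalgHomClass.map_comp_comul_apply e.symm
        (AddMonoidAlgebra.single m (1 : K))
      rw [← h]
      simp [g]
    have hcou : ∀ m, Coalgebra.counit (R := K) (g m) = 1 := by
      intro m
      simp [g]
    obtain ⟨F, hF⟩ : ∃ F : M →₀ V, ρ.coact v = F.sum fun m x => x ⊗ₜ[K] g m := by
      refine ⟨TensorProduct.equivFinsuppOfBasisRight B (ρ.coact v), ?_⟩
      have := TensorProduct.equivFinsuppOfBasisRight_symm_apply (M := V) B
        (TensorProduct.equivFinsuppOfBasisRight B (ρ.coact v))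
      simpa [hB] using this
    have hsum : v = F.sum fun _ x => x := by
      have h := congrArg (TensorProduct.rid K V) (ρ.counit v)
      rw [hF] at h
      simpa [Finsupp.sum, hcou] using h.symm
    have hW : ∀ m, F m ∈ W := by
      intro m
      refine ⟨m, ?_⟩
      have h := congrArg ((TensorProduct.rid K A).toLinearMap.lTensor V ∘ₗ
        ((B.coord m).lTensor A).lTensor V) (ρ.coassoc v)
      rw [hF] at h
      have hc : ∀ m', B.coord m (g m') = if m' = m then 1 else 0 := by
        intro m'
        rw [← hB, Module.Basis.coord_apply, B.repr_self, Finsupp.single_apply]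
      have hass : ∀ (z : V ⊗[K] A) (a : A),
          ((TensorProduct.rid K A).toLinearMap.lTensor V)
            ((((B.coord m).lTensor A).lTensor V) (TensorProduct.assoc K V A A (z ⊗ₜ[K] a))) =
          B.coord m a • z := by
        intro z a
        induction z with
        | zero => simp
        | add x y hx hy => rw [TensorProduct.add_tmul, map_add, map_add, map_add, hx, hy, smul_add]
        | tmul x y => simp
      simp only [Finsupp.sum, map_sum, LinearMap.rTensor_tmul, LinearMap.comp_apply, hass,
        LinearMap.lTensor_tmul, hcom, hc] at h
      rw [Finset.sum_eq_single m (by intro x _ hx; simp [hx])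
          (by intro hm; simp [Finsupp.notMem_support_iff.1 hm]),
        Finset.sum_eq_single m (by intro x _ hx; simp [hx])
          (by intro hm; simp [Finsupp.notMem_support_iff.1 hm])] at h
      simpa using h
    rw [hsum]
    exact Submodule.sum_mem _ fun m _ => Submodule.subset_span (hW m)
  let b₀ := Module.Basis.ofSpan hspan
  have hb₀ : ∀ i, b₀ i ∈ W := fun i => Module.Basis.ofSpan_subset hspan ⟨i, rfl⟩
  let b := b₀.reindex (Fintype.equivFinOfCardEq (Module.finrank_eq_card_basis b₀).symm)
  have hb : ∀ i, ∃ m, ρ.coact (b i) = b i ⊗ₜ[K] g m := fun i => by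
    rw [Module.Basis.reindex_apply]
    exact hb₀ _
  choose S hS using hb
  exact ⟨b, S, hS⟩

section coordinates

variable {n : ℕ} (ρ : RationalRep K A V) (b : Module.Basis (Fin n) K V)

/-- The coordinates of a point of `V ⊕ V*`: `Sum.inl` for the coordinates in `V` along `b`,
`Sum.inr` for those in `V*` along the dual basis. -/
noncomputable def coords (p : V × Module.Dual K V) : Fin n ⊕ Fin n → K :=
  Sum.elim (fun i => b.repr p.1 i) (fun i => p.2 (b i))

/-- The component `(x, φ) ↦ φ (D • x)` of the moment map, as a polynomial on `V ⊕ V*`. -/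
noncomputable def momentPoly (D : lieSpace K A) : MvPolynomial (Fin n ⊕ Fin n) K :=
  ∑ i, ∑ k, MvPolynomial.C (b.repr (ρ.lieAct D (b k)) i) *
    MvPolynomial.X (Sum.inl k) * MvPolynomial.X (Sum.inr i)

theorem eval_momentPoly (D : lieSpace K A) (p : V × Module.Dual K V) :
    MvPolynomial.eval (coords b p) (ρ.momentPoly b D) = ρ.momentMap p D := by
  have h : ρ.momentMap p D = p.2 (ρ.lieAct D p.1) := rfl
  rw [h]
  conv_rhs => rw [← b.sum_repr p.1, map_sum, map_sum]
  simp only [momentPoly, map_sum, map_mul, MvPolynomial.eval_C, MvPolynomial.eval_X, coords,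
    Sum.elim_inl, Sum.elim_inr, map_smul]
  rw [Finset.sum_comm]
  refine Finset.sum_congr rfl fun k _ => ?_
  conv_rhs => rw [← b.sum_repr (ρ.lieAct D (b k)), map_sum, Finset.smul_sum]
  refine Finset.sum_congr rfl fun i _ => ?_
  simp only [map_smul, smul_eq_mul]
  ring

/-- The ideal of the scheme-theoretic fibre `μ⁻¹(0)` in the coordinate ring of `V ⊕ V*`. -/
noncomputable def nullIdeal : Ideal (MvPolynomial (Fin n ⊕ Fin n) K) :=
  Ideal.span (Set.range (ρ.momentPoly b))

/-- The coordinate ring of the affine scheme `μ⁻¹(0)`. -/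
abbrev NullRing : Type _ := MvPolynomial (Fin n ⊕ Fin n) K ⧸ ρ.nullIdeal b

/-- The underlying topological space of the affine scheme `μ⁻¹(0)`. -/
abbrev NullFiber : Type _ := PrimeSpectrum (ρ.NullRing b)

/-- Evaluation of the functions on `μ⁻¹(0)` at a `K`-point. -/
noncomputable def evalAt (p : {p : V × Module.Dual K V // ρ.momentMap p = 0}) :
    ρ.NullRing b →+* K :=
  Ideal.Quotient.lift (ρ.nullIdeal b) (MvPolynomial.eval (coords b p.1)) (by
    intro f hf
    have h : ρ.nullIdeal b ≤ RingHom.ker (MvPolynomial.eval (coords b p.1)) := by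
      refine Ideal.span_le.2 ?_
      rintro _ ⟨D, rfl⟩
      simp [RingHom.mem_ker, eval_momentPoly, p.2]
    exact h hf)

/-- The closed point of the scheme `μ⁻¹(0)` given by a pair `(x, φ)` with `μ (x, φ) = 0`. -/
noncomputable def closedPoint (p : {p : V × Module.Dual K V // ρ.momentMap p = 0}) :
    ρ.NullFiber b :=
  ⟨RingHom.ker (ρ.evalAt b p), RingHom.ker_isPrime _⟩

/-- The stratum `J_I` of the vectors of `V` whose nonzero coordinates are exactly those in `I`. -/
def stratum (I : Finset (Fin n)) : Set V := {v | ∀ i, b.repr v i ≠ 0 ↔ i ∈ I}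

/-- The subset `μ⁻¹(0)_X = {(x, φ) ∈ μ⁻¹(0) | x ∈ X}` of `μ⁻¹(0)`. -/
def nullOver (X : Set V) : Set (ρ.NullFiber b) := ρ.closedPoint b '' {p | p.1.1 ∈ X}

end coordinates

end RationalRep

/-! In weight coordinates the ideal of the zero fibre is generated by the quadrics `∑ w_i x_i y_i`
with `w` in the column space `W` of `S` over `K`. The vector of products `x_i y_i` is thus
annihilated by `W`. Taking coordinates `u` on `K^n / W`, with `d = n - rk S`, turns the coordinate
ring into `K[u][x, y] / (x_i y_i - ℓ_i(u))`, where `ℓ_i` is the linear form given by the class of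
`e_i`, and `ℓ_i = 0` iff `e_i ∈ W` (`quotEquiv`, `coordForm_ne_zero_iff`).

This ring is a tower of hyperbolas `B[x, y] / (x y - f)`. Such a step preserves reducedness and
nonzerodivisors, raises the dimension by one, and preserves integrally closed domains if `f ≠ 0`;
all but the dimension come from the two charts `x ≠ 0` and `y ≠ 0`, which embed the ring in Laurent
polynomials. This gives reducedness, dimension `d + n = 2n - rk S`, and normality and irreducibility
when no `e_i` lies in `W`. If `e_i ∈ W`, then `x_i y_i = 0` with neither factor zero in the local
ring at the origin, so both properties fail.

For the components, a stratum `J_I` with `e_i ∈ W` for all `i ∉ I` has a fibre parametrized by an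
open subset of affine space, so its vanishing ideal is prime (`stratumIdeal_eq_ker`). These ideals
are pairwise incomparable. Their intersection is the ideal of the fibre, because the `x_i` with `e_i
∉ W` are nonzerodivisors (`mem_quadIdeal_of_forall_stratumIdeal`). Rank-nullity translates the
conditions on `rk S_I` into conditions on the `e_i`. -/

/-- Incomparability of primes gives `≤`; lying over and going up lift chains and give `≥`. -/
theorem Algebra.IsIntegral.ringKrullDim_eq (R S : Type*) [CommRing R] [CommRing S] [Algebra R S]
    [Algebra.IsIntegral R S] [FaithfulSMul R S] : ringKrullDim S = ringKrullDim R := by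
  apply le_antisymm
  · refine Order.krullDim_le_of_strictMono (PrimeSpectrum.comap (algebraMap R S)) ?_
    intro p q hpq
    exact Ideal.IsIntegral.comap_lt_comap hpq
  · refine iSup_le fun l => ?_
    obtain ⟨⟨Q, hQ, hlo⟩⟩ := Ideal.nonempty_primesOver (S := S) (RelSeries.head l).asIdeal
    obtain ⟨L, hL, -⟩ := Ideal.exists_ltSeries_of_hasGoingUp l Q
    rw [← hL]
    exact le_iSup (fun L : LTSeries (PrimeSpectrum S) => (L.length : WithBot ℕ∞)) L

/-! ### Coefficients and ring properties of Laurent polynomials. -/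

namespace LaurentPolynomial

variable {B : Type*} [CommRing B]

theorem coeff_toLaurent_natCast (p : Polynomial B) (k : ℕ) :
    (Polynomial.toLaurent p).coeff (k : ℤ) = p.coeff k := by
  rw [LaurentPolynomial.coeff_toLaurent]
  exact Finsupp.mapDomain_apply Nat.castEmbedding.injective _ k

theorem coeff_toLaurent_of_neg (p : Polynomial B) {m : ℤ} (hm : m < 0) :
    (Polynomial.toLaurent p).coeff m = 0 := by
  rw [LaurentPolynomial.coeff_toLaurent]
  refine Finsupp.mapDomain_of_notMem_range _ _ ?_
  rintro ⟨k, rfl⟩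
  simp at hm
  omega

theorem coeff_mul_T (g : B[T;T⁻¹]) (m k : ℤ) : (g * T m).coeff k = g.coeff (k - m) := by
  induction g using LaurentPolynomial.induction_on' with
  | add p q hp hq => simp [add_mul, hp, hq]
  | C_mul_T n a =>
    rw [mul_assoc, ← T_add, ← single_eq_C_mul_T, ← single_eq_C_mul_T]
    simp only [AddMonoidAlgebra.coeff_single, Finsupp.single_apply]
    congr 1
    simp only [eq_iff_iff]
    omega

theorem coeff_C_mul (b : B) (g : B[T;T⁻¹]) (k : ℤ) : (C b * g).coeff k = b * g.coeff k := by
  rw [← smul_eq_C_mul]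
  simp

instance isReduced [IsReduced B] : IsReduced B[T;T⁻¹] := by
  have : IsReduced (Polynomial B) := by
    have e := MvPolynomial.uniqueAlgEquiv B Unit
    exact isReduced_of_injective e.symm e.symm.injective
  exact isReduced_localizationPreserves (Submonoid.powers (Polynomial.X : Polynomial B)) _ this

instance isDomain [IsDomain B] : IsDomain B[T;T⁻¹] :=
  IsLocalization.isDomain_of_le_nonZeroDivisors (R := Polynomial B)
    (M := Submonoid.powers Polynomial.X) _
    (powers_le_nonZeroDivisors_of_noZeroDivisors Polynomial.X_ne_zero)

instance isIntegrallyClosed [IsDomain B] [IsIntegrallyClosed B] : IsIntegrallyClosed B[T;T⁻¹] :=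
  isIntegrallyClosed_of_isLocalization (R := Polynomial B) _ (Submonoid.powers Polynomial.X)
    (powers_le_nonZeroDivisors_of_noZeroDivisors Polynomial.X_ne_zero)

end LaurentPolynomial

/-! ### One hyperbola `B[x, y] / (x y - f)` and its two charts. -/

open LaurentPolynomial

/-- The ring map `φ : B → C` and the elements `x`, `y` present `C` as `B[x, y] / (x y - f)`.
The last two fields describe the two charts `x ≠ 0` and `y ≠ 0`. -/
structure IsHyperbola {B C : Type*} [CommRing B] [CommRing C] (φ : B →+* C) (f : B) (x y : C) :
    Prop where
  mul_eq : x * y = φ f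
  induction : ∀ (M : C → Prop) (_one : M 1) (_add : ∀ c d, M c → M d → M (c + d))
    (_scalar : ∀ b c, M c → M (φ b * c)) (_left : ∀ c, M c → M (x * c))
    (_right : ∀ c, M c → M (y * c)) (c : C), M c
  exists_left : ∃ α : C →+* B[T;T⁻¹], (∀ b, α (φ b) = LaurentPolynomial.C b) ∧ α x = T 1 ∧
    α y = LaurentPolynomial.C f * T (-1)
  exists_right : ∃ β : C →+* B[T;T⁻¹], (∀ b, β (φ b) = LaurentPolynomial.C b) ∧ β y = T 1 ∧
    β x = LaurentPolynomial.C f * T (-1)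

namespace IsHyperbola

variable {B C : Type*} [CommRing B] [CommRing C] {φ : B →+* C} {f : B} {x y : C}

theorem symm (h : IsHyperbola φ f x y) : IsHyperbola φ f y x where
  mul_eq := by rw [mul_comm, h.mul_eq]
  induction M h1 ha hb hx hy := h.induction M h1 ha hb hy hx
  exists_left := h.exists_right
  exists_right := h.exists_left

/-- The relation removes mixed monomials. The factor `y` in front of `q` keeps constants from being
counted in both parts. -/
theorem exists_normalForm (h : IsHyperbola φ f x y) (c : C) :
    ∃ p q : Polynomial B, c = p.eval₂ φ x + y * q.eval₂ φ y := by
  have key := h.mul_eq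
  induction c using h.induction with
  | _one => exact ⟨1, 0, by simp⟩
  | _add c d hc hd =>
    obtain ⟨p, q, rfl⟩ := hc
    obtain ⟨p', q', rfl⟩ := hd
    exact ⟨p + p', q + q', by simp only [Polynomial.eval₂_add]; ring⟩
  | _scalar b c hc =>
    obtain ⟨p, q, rfl⟩ := hc
    exact ⟨Polynomial.C b * p, Polynomial.C b * q, by
      simp only [Polynomial.eval₂_mul, Polynomial.eval₂_C]; ring⟩
  | _left c hc =>
    obtain ⟨p, q, rfl⟩ := hc
    -- Here `x * y * q(y) = f q(y)`; its constant term `f q(0)` goes to the `x` part and the rest is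
    -- `y` times `f * divX q`.
    refine ⟨Polynomial.X * p + Polynomial.C (f * q.coeff 0), Polynomial.C f * q.divX, ?_⟩
    conv_lhs => rw [← q.divX_mul_X_add]
    simp only [Polynomial.eval₂_mul, Polynomial.eval₂_C, Polynomial.eval₂_add, Polynomial.eval₂_X,
      map_mul]
    linear_combination (Polynomial.eval₂ φ y q.divX * y + φ (q.coeff 0)) * key
  | _right c hc =>
    obtain ⟨p, q, rfl⟩ := hc
    refine ⟨Polynomial.C f * p.divX, Polynomial.C (p.coeff 0) + Polynomial.X * q, ?_⟩
    conv_lhs => rw [← p.divX_mul_X_add]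
    simp only [Polynomial.eval₂_mul, Polynomial.eval₂_C, Polynomial.eval₂_add, Polynomial.eval₂_X]
    linear_combination (Polynomial.eval₂ φ x p.divX) * key

section charts

variable {α : C →+* B[T;T⁻¹]} (h1 : ∀ b, α (φ b) = LaurentPolynomial.C b) (hx : α x = T 1)
  (hy : α y = LaurentPolynomial.C f * T (-1))

include h1 hx hy

/-- The two parts occupy the degrees `≥ 0` and `< 0`. Since `y = f T⁻¹`, the coefficient of `y ^ k`
reappears multiplied by `f ^ k`. -/
theorem chart_normalForm (p q : Polynomial B) :
    α (p.eval₂ φ x + y * q.eval₂ φ y) = Polynomial.toLaurent p +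
      LaurentPolynomial.C f * (invert (Polynomial.toLaurent
        (q.comp (Polynomial.C f * Polynomial.X))) * T (-1)) := by
  have hC : α.comp φ = LaurentPolynomial.C := RingHom.ext h1
  have e1 : ∀ p : Polynomial B, Polynomial.toLaurent p = p.eval₂ LaurentPolynomial.C (T 1) := by
    intro p
    induction p using Polynomial.induction_on' with
    | add p q hp hq => simp [hp, hq]
    | monomial n a =>
      rw [← Polynomial.C_mul_X_pow_eq_monomial, Polynomial.toLaurent_C_mul_X_pow]
      simp [T_pow]
  have e2 : ∀ q : Polynomial B, invert (Polynomial.toLaurent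
      (q.comp (Polynomial.C f * Polynomial.X))) =
        q.eval₂ LaurentPolynomial.C (LaurentPolynomial.C f * T (-1)) := by
    intro q
    induction q using Polynomial.induction_on' with
    | add p q hp hq => simp [hp, hq]
    | monomial n a =>
      simp [mul_pow, T_pow]
  rw [map_add, map_mul, Polynomial.hom_eval₂, Polynomial.hom_eval₂, hC, hx, hy, e1, e2]
  ring

theorem coeff_chart_natCast (p q : Polynomial B) (k : ℕ) :
    (α (p.eval₂ φ x + y * q.eval₂ φ y)).coeff (k : ℤ) = p.coeff k := by
  rw [chart_normalForm h1 hx hy]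
  simp only [AddMonoidAlgebra.coeff_add, Finsupp.add_apply, coeff_toLaurent_natCast, coeff_C_mul,
    coeff_mul_T, invert_apply]
  rw [coeff_toLaurent_of_neg _ (by omega)]
  simp

theorem coeff_chart_neg (p q : Polynomial B) (k : ℕ) :
    (α (p.eval₂ φ x + y * q.eval₂ φ y)).coeff (-((k + 1 : ℕ) : ℤ)) = q.coeff k * f ^ (k + 1) := by
  rw [chart_normalForm h1 hx hy]
  simp only [AddMonoidAlgebra.coeff_add, Finsupp.add_apply, coeff_C_mul,
    coeff_mul_T, invert_apply]
  rw [coeff_toLaurent_of_neg _ (by omega),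
    show -(-((k + 1 : ℕ) : ℤ) - -1) = (k : ℤ) by push_cast; ring, coeff_toLaurent_natCast,
    Polynomial.comp_C_mul_X_coeff]
  ring

theorem chart_injective (h : IsHyperbola φ f x y) (hf : f ∈ nonZeroDivisors B) :
    Function.Injective α := by
  rw [injective_iff_map_eq_zero]
  intro c hc
  obtain ⟨p, q, rfl⟩ := h.exists_normalForm c
  have hp : p = 0 := by
    ext k
    rw [← coeff_chart_natCast h1 hx hy p q k, hc]
    simp
  have hq : q = 0 := by
    ext k
    have := coeff_chart_neg h1 hx hy p q k
    rw [hc] at this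
    exact (mul_right_mem_nonZeroDivisors_eq_zero_iff (pow_mem hf (k + 1))).1 this.symm
  simp [hp, hq]

/-- The element `φ a * y ^ k` maps to `a f ^ k T ^ (-k)`. This description reduces normality to a
divisibility check. -/
theorem mem_range_chart_iff (h : IsHyperbola φ f x y) (g : B[T;T⁻¹]) :
    g ∈ Set.range α ↔ ∀ k : ℕ, f ^ k ∣ g.coeff (-(k : ℤ)) := by
  constructor
  · rintro ⟨c, rfl⟩ k
    obtain ⟨p, q, rfl⟩ := h.exists_normalForm c
    cases k with
    | zero => simp
    | succ k =>
      rw [coeff_chart_neg h1 hx hy]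
      exact Dvd.intro_left _ rfl
  · intro hg
    change g ∈ (α.range : Set _)
    have hsum : g = ∑ m ∈ g.coeff.support, LaurentPolynomial.C (g.coeff m) * T m := by
      apply LaurentPolynomial.ext
      intro a
      simp only [AddMonoidAlgebra.coeff_sum, Finsupp.finsetSum_apply, coeff_C_mul, T_apply]
      simp
    rw [hsum]
    refine Subring.sum_mem _ fun m _ => ?_
    rcases le_or_gt 0 m with hm | hm
    · obtain ⟨k, rfl⟩ := Int.eq_ofNat_of_zero_le hm
      exact ⟨φ (g.coeff k) * x ^ k, by simp [h1, hx, T_pow]⟩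
    · obtain ⟨k, rfl⟩ := Int.exists_eq_neg_ofNat hm.le
      obtain ⟨a, ha⟩ := hg k
      refine ⟨φ a * y ^ k, ?_⟩
      rw [ha, map_mul, map_pow, h1, hy, mul_pow, T_pow, map_mul, map_pow]
      simp only [mul_neg, mul_one]
      ring

end charts

/-- When `f` is a zero divisor or zero, one chart may lose the `y` part. The other chart recovers
it, so the two are jointly injective for every `f`. -/
theorem eq_zero_of_charts {α β : C →+* B[T;T⁻¹]} (h : IsHyperbola φ f x y)
    (h1 : ∀ b, α (φ b) = LaurentPolynomial.C b) (hx : α x = T 1)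
    (hy : α y = LaurentPolynomial.C f * T (-1))
    (h1' : ∀ b, β (φ b) = LaurentPolynomial.C b) (hy' : β y = T 1)
    (hx' : β x = LaurentPolynomial.C f * T (-1)) {c : C} (hα : α c = 0) (hβ : β c = 0) : c = 0 := by
  obtain ⟨p, q, rfl⟩ := h.exists_normalForm c
  have hp : p = 0 := by
    ext k
    rw [← coeff_chart_natCast h1 hx hy p q k, hα]
    simp
  subst hp
  -- With `p = 0` the element is the pure polynomial `X * q` in `y`, whose coefficients are visible
  -- in the chart `y = T`.
  have hq : Polynomial.X * q = 0 := by
    ext k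
    rw [← coeff_chart_natCast h1' hy' hx' (Polynomial.X * q) 0 k]
    have : Polynomial.eval₂ φ y (Polynomial.X * q) + x * Polynomial.eval₂ φ x 0 =
      Polynomial.eval₂ φ x 0 + y * Polynomial.eval₂ φ y q := by simp [Polynomial.eval₂_mul]
    rw [this, hβ]
    simp
  have : y * Polynomial.eval₂ φ y q = Polynomial.eval₂ φ y (Polynomial.X * q) := by
    simp [Polynomial.eval₂_mul]
  rw [this, hq]
  simp

theorem isReduced [IsReduced B] (h : IsHyperbola φ f x y) : IsReduced C := by
  obtain ⟨α, h1, hx, hy⟩ := h.exists_left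
  obtain ⟨β, h1', hy', hx'⟩ := h.exists_right
  refine ⟨fun c hc => h.eq_zero_of_charts h1 hx hy h1' hy' hx' ?_ ?_⟩
  · exact (hc.map α).eq_zero
  · exact (hc.map β).eq_zero

theorem map_mem_nonZeroDivisors (h : IsHyperbola φ f x y) {b : B} (hb : b ∈ nonZeroDivisors B) :
    φ b ∈ nonZeroDivisors C := by
  obtain ⟨α, h1, hx, hy⟩ := h.exists_left
  obtain ⟨β, h1', hy', hx'⟩ := h.exists_right
  have key : ∀ g : B[T;T⁻¹], g * LaurentPolynomial.C b = 0 → g = 0 := by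
    intro g hg
    apply LaurentPolynomial.ext
    intro m
    have := congrArg (fun u : B[T;T⁻¹] => u.coeff m) hg
    simp only [mul_comm g, coeff_C_mul] at this
    rw [mul_comm] at this
    exact (mul_right_mem_nonZeroDivisors_eq_zero_iff hb).1 (by simpa using this)
  refine mem_nonZeroDivisors_iff_right.2 fun c hc => ?_
  refine h.eq_zero_of_charts h1 hx hy h1' hy' hx' (key _ ?_) (key _ ?_)
  · rw [← h1, ← map_mul, hc, map_zero]
  · rw [← h1', ← map_mul, hc, map_zero]

theorem isDomain [IsDomain B] (h : IsHyperbola φ f x y) (hf : f ≠ 0) : IsDomain C := by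
  obtain ⟨α, h1, hx, hy⟩ := h.exists_left
  exact (chart_injective h1 hx hy h (mem_nonZeroDivisors_of_ne_zero hf)).isDomain α

/-- Once `x` is invertible, `y = f / x` is redundant and only `B[x, x⁻¹]` is left. -/
theorem isLocalization_chart [IsDomain B] (h : IsHyperbola φ f x y) (hf : f ≠ 0)
    {α : C →+* B[T;T⁻¹]} (h1 : ∀ b, α (φ b) = LaurentPolynomial.C b) (hx : α x = T 1)
    (hy : α y = LaurentPolynomial.C f * T (-1)) :
    let := α.toAlgebra
    IsLocalization.Away x B[T;T⁻¹] := by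
  let := α.toAlgebra
  have hα : algebraMap C B[T;T⁻¹] = α := rfl
  refine ⟨?_, ?_, ?_⟩
  · rintro ⟨_, n, rfl⟩
    simp only [hα, map_pow, hx]
    exact (isUnit_T 1).pow n
  · intro g
    obtain ⟨n, p, hp⟩ := exists_T_pow g
    refine ⟨(p.eval₂ φ x, ⟨x ^ n, n, rfl⟩), ?_⟩
    have := chart_normalForm h1 hx hy p 0
    simp only [Polynomial.eval₂_zero, mul_zero, add_zero, Polynomial.zero_comp, map_zero,
      zero_mul] at this
    simp [hα, hx, this, hp, T_pow]
  · intro a b hab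
    exact ⟨1, by rw [chart_injective h1 hx hy h (mem_nonZeroDivisors_of_ne_zero hf) hab]⟩

/-- An element integral over `C` is integral over `D = C[1/x]`, hence lies in `D`; then the
denominator is cleared. -/
theorem exists_pow_mul_eq_algebraMap {C D K : Type*} [CommRing C] [IsDomain C] [CommRing D]
    [IsDomain D] [IsIntegrallyClosed D] [Algebra C D] [Field K] [Algebra C K] [IsFractionRing C K]
    {x : C} (hx : x ≠ 0) [IsLocalization.Away x D] {z : K} (hz : IsIntegral C z) :
    ∃ (n : ℕ) (a : C), algebraMap C K x ^ n * z = algebraMap C K a := by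
  have hM : Submonoid.powers x ≤ nonZeroDivisors C := powers_le_nonZeroDivisors_of_noZeroDivisors hx
  let g : D →+* K := IsLocalization.map _ (T := nonZeroDivisors C) (RingHom.id C) hM
  let := g.toAlgebra
  have : IsScalarTower C D K := IsScalarTower.of_algebraMap_eq'
    (by
      change _ = g.comp (algebraMap C D)
      rw [IsLocalization.map_comp hM, RingHomCompTriple.comp_eq])
  have := IsFractionRing.isFractionRing_of_isDomain_of_isLocalization (Submonoid.powers x) D K
  obtain ⟨d, hd⟩ := (isIntegrallyClosed_iff K).1 ‹IsIntegrallyClosed D› hz.tower_top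
  obtain ⟨⟨a, _, n, rfl⟩, ha⟩ := IsLocalization.surj (Submonoid.powers x) d
  refine ⟨n, a, ?_⟩
  have := congrArg (algebraMap D K) ha
  rw [map_mul, ← IsScalarTower.algebraMap_apply, ← IsScalarTower.algebraMap_apply, hd] at this
  rw [← this, mul_comm]
  simp

/-- An integral `z` lies in both `C[1/x]` and `C[1/y]`, which are normal, and the intersection of
these two rings is `C`. -/
theorem isIntegrallyClosed [IsDomain B] [IsIntegrallyClosed B] (h : IsHyperbola φ f x y)
    (hf : f ≠ 0) : IsIntegrallyClosed C := by
  have := h.isDomain hf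
  obtain ⟨α, h1, hx, hy⟩ := h.exists_left
  obtain ⟨β, h1', hy', hx'⟩ := h.exists_right
  have hinj := chart_injective h1 hx hy h (mem_nonZeroDivisors_of_ne_zero hf)
  have hTne : ∀ m : ℤ, (T m : B[T;T⁻¹]) ≠ 0 := fun m => (isUnit_T m).ne_zero
  have hx0 : x ≠ 0 := by
    rintro rfl
    exact hTne 1 (by rw [← hx, map_zero])
  have hy0 : y ≠ 0 := by
    rintro rfl
    exact hTne 1 (by rw [← hy', map_zero])
  rw [isIntegrallyClosed_iff (FractionRing C)]
  intro z hz
  obtain ⟨n, a, ha⟩ : ∃ (n : ℕ) (a : C), algebraMap C (FractionRing C) x ^ n * z =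
      algebraMap C _ a := by
    let := α.toAlgebra
    have := h.isLocalization_chart hf h1 hx hy
    exact exists_pow_mul_eq_algebraMap (D := B[T;T⁻¹]) hx0 hz
  obtain ⟨m, b, hb⟩ : ∃ (n : ℕ) (a : C), algebraMap C (FractionRing C) y ^ n * z =
      algebraMap C _ a := by
    let := β.toAlgebra
    have := h.symm.isLocalization_chart hf h1' hy' hx'
    exact exists_pow_mul_eq_algebraMap (D := B[T;T⁻¹]) hy0 hz
  have hab : y ^ m * a = x ^ n * b := by
    apply IsFractionRing.injective C (FractionRing C)
    simp only [map_mul, map_pow, ← ha, ← hb]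
    ring
  have hab' : LaurentPolynomial.C (f ^ m) * (α a * T (-(m : ℤ))) = α b * T n := by
    have := congrArg α hab
    simp only [map_mul, map_pow, hx, hy, mul_pow, T_pow, mul_one, mul_neg] at this
    rw [mul_comm (α b), ← this, map_pow]
    ring
  obtain ⟨c, hc⟩ : α a * T (-(n : ℤ)) ∈ Set.range α := by
    rw [mem_range_chart_iff h1 hx hy h]
    intro k
    -- In this degree the left side is `f ^ m` times the coefficient of `α a * T (-n)` at `-k`, and
    -- the right side is the coefficient of `α b` at `-(k + m)`, divisible by `f ^ (k + m)`.
    -- Cancelling `f ^ m` gives the criterion.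
    have h3 := congrArg (fun u : B[T;T⁻¹] => u.coeff (-(k : ℤ) + n - m)) hab'
    simp only [coeff_C_mul, coeff_mul_T] at h3
    have h4 := (mem_range_chart_iff h1 hx hy h (α b)).1 ⟨b, rfl⟩ (k + m)
    rw [show -((k + m : ℕ) : ℤ) = -(k : ℤ) + n - m - n by push_cast; ring, ← h3, pow_add,
      mul_comm (f ^ k)] at h4
    rw [coeff_mul_T]
    convert (mul_dvd_mul_iff_left (pow_ne_zero m hf)).1 h4 using 2
    ring
  refine ⟨c, ?_⟩
  have hca : x ^ n * c = a := by
    apply hinj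
    rw [map_mul, map_pow, hx, hc, mul_comm, mul_assoc, T_pow, ← T_add]
    simp
  rw [← hca, map_mul, map_pow] at ha
  refine (mul_left_cancel₀ (pow_ne_zero n ?_) ha).symm
  simpa using hx0

/-- Noether normalization by `s = x + y`: both `x` and `y` are roots of `X² - s X + f`, so `C` is
integral over the polynomial ring `B[s]`. -/
theorem ringKrullDim_eq [IsNoetherianRing B] (h : IsHyperbola φ f x y) :
    ringKrullDim C = ringKrullDim B + 1 := by
  let := (Polynomial.eval₂RingHom φ (x + y)).toAlgebra
  have hmap : ∀ p, algebraMap (Polynomial B) C p = p.eval₂ φ (x + y) := fun p => rfl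
  have hroot : ∀ u v : C, u + v = x + y → u * v = φ f → IsIntegral (Polynomial B) u := by
    intro u v huv huv'
    refine ⟨Polynomial.X ^ 2 + (Polynomial.C (-Polynomial.X) * Polynomial.X +
      Polynomial.C (Polynomial.C f)), ?_, ?_⟩
    · exact Polynomial.monic_X_pow_add (by compute_degree!)
    · simp only [Polynomial.eval₂_add, Polynomial.eval₂_mul, Polynomial.eval₂_C,
        Polynomial.eval₂_X, Polynomial.eval₂_X_pow, hmap, Polynomial.eval₂_neg]
      rw [← huv, ← huv']
      ring
  have : Algebra.IsIntegral (Polynomial B) C := by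
    refine ⟨fun c => ?_⟩
    induction c using h.induction with
    | _one => exact isIntegral_one
    | _add c d hc hd => exact hc.add hd
    | _scalar b c hc =>
      refine IsIntegral.mul ?_ hc
      have : φ b = algebraMap (Polynomial B) C (Polynomial.C b) := by simp [hmap]
      rw [this]
      exact isIntegral_algebraMap
    | _left c hc => exact (hroot x y rfl h.mul_eq).mul hc
    | _right c hc => exact (hroot y x (add_comm _ _) (by rw [mul_comm, h.mul_eq])).mul hc
  have : FaithfulSMul (Polynomial B) C := by
    rw [faithfulSMul_iff_algebraMap_injective, injective_iff_map_eq_zero]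
    intro p hp
    obtain ⟨α, h1, hx, hy⟩ := h.exists_left
    have hC : α.comp φ = LaurentPolynomial.C := RingHom.ext h1
    by_contra hp0
    -- In the chart `s = T + f T⁻¹`, so `s ^ n` has top term `T ^ n` with coefficient one. Hence a
    -- polynomial in `s` keeps its leading coefficient, and `B[s] → C` is injective.
    have e : ∀ n : ℕ, (∀ m : ℤ, (n : ℤ) < m →
        (((T 1 + LaurentPolynomial.C f * T (-1)) ^ n : B[T;T⁻¹])).coeff m = 0) ∧
        (((T 1 + LaurentPolynomial.C f * T (-1)) ^ n : B[T;T⁻¹])).coeff n = 1 := by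
      intro n
      have hs : ∀ (g : B[T;T⁻¹]) (m : ℤ), (g * (T 1 + LaurentPolynomial.C f * T (-1))).coeff m =
          g.coeff (m - 1) + f * g.coeff (m + 1) := by
        intro g m
        rw [mul_add, mul_left_comm, AddMonoidAlgebra.coeff_add, Finsupp.add_apply, coeff_mul_T,
          coeff_C_mul, coeff_mul_T]
        simp
      induction n with
      | zero =>
        constructor
        · intro m hm
          rw [pow_zero, ← T_zero, T_apply, if_neg]
          rintro rfl
          simp at hm
        · rw [pow_zero, ← T_zero, T_apply]
          simp
      | succ n ih =>
        simp only [pow_succ, hs]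
        constructor
        · intro m hm
          rw [ih.1 _ (by push_cast at hm; omega), ih.1 _ (by push_cast at hm; omega)]
          simp
        · rw [ih.1 (((n + 1 : ℕ) : ℤ) + 1) (by push_cast; omega)]
          simpa using ih.2
    have h0 := congrArg α hp
    rw [hmap, Polynomial.hom_eval₂, hC, map_add, hx, hy, map_zero,
      Polynomial.eval₂_eq_sum_range] at h0
    have h2 := congrArg (fun u : B[T;T⁻¹] => u.coeff p.natDegree) h0
    simp only [AddMonoidAlgebra.coeff_sum, Finsupp.finsetSum_apply, coeff_C_mul] at h2
    rw [Finset.sum_range_succ, (e p.natDegree).2, Finset.sum_eq_zero] at h2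
    · exact hp0 (Polynomial.leadingCoeff_eq_zero.1 (by simpa using h2))
    · intro k hk
      rw [(e k).1 _ (by simpa using hk), mul_zero]
  rw [Algebra.IsIntegral.ringKrullDim_eq (Polynomial B) C,
    Polynomial.ringKrullDim_of_isNoetherianRing]

end IsHyperbola

/-! ### Towers of hyperbolas. -/

/-- The ideal generated by the polynomials `x_i y_i - ℓ_i`. -/
noncomputable def hyperbolaIdeal {P : Type*} [CommRing P] {n : ℕ} (ℓ : Fin n → P) :
    Ideal (MvPolynomial (Fin n ⊕ Fin n) P) :=
  Ideal.span (Set.range fun i : Fin n =>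
    MvPolynomial.X (Sum.inl i) * MvPolynomial.X (Sum.inr i) - MvPolynomial.C (ℓ i))

/-- The ring `P[x_i, y_i] / (x_i y_i - ℓ_i)`. -/
def HyperbolaRing (P : Type*) [CommRing P] {n : ℕ} (ℓ : Fin n → P) : Type _ :=
  MvPolynomial (Fin n ⊕ Fin n) P ⧸ hyperbolaIdeal ℓ

namespace HyperbolaRing

variable {P : Type*} [CommRing P] {n : ℕ}

noncomputable instance (ℓ : Fin n → P) : CommRing (HyperbolaRing P ℓ) :=
  inferInstanceAs (CommRing (MvPolynomial (Fin n ⊕ Fin n) P ⧸ hyperbolaIdeal ℓ))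

instance [IsNoetherianRing P] (ℓ : Fin n → P) : IsNoetherianRing (HyperbolaRing P ℓ) :=
  inferInstanceAs (IsNoetherianRing (MvPolynomial (Fin n ⊕ Fin n) P ⧸ hyperbolaIdeal ℓ))

/-- The quotient map to `P[x_i, y_i] / (x_i y_i - ℓ_i)`. -/
noncomputable def mk (ℓ : Fin n → P) : MvPolynomial (Fin n ⊕ Fin n) P →+* HyperbolaRing P ℓ :=
  Ideal.Quotient.mk (hyperbolaIdeal ℓ)

/-- The structure map of `P[x_i, y_i] / (x_i y_i - ℓ_i)`. -/
noncomputable def of (ℓ : Fin n → P) : P →+* HyperbolaRing P ℓ :=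
  (mk ℓ).comp MvPolynomial.C

/-- The coordinates of `P[x_i, y_i] / (x_i y_i - ℓ_i)`. -/
noncomputable def var (ℓ : Fin n → P) (s : Fin n ⊕ Fin n) : HyperbolaRing P ℓ :=
  mk ℓ (MvPolynomial.X s)

theorem var_mul_var (ℓ : Fin n → P) (i : Fin n) :
    var ℓ (Sum.inl i) * var ℓ (Sum.inr i) = of ℓ (ℓ i) := by
  refine (Ideal.Quotient.mk_eq_mk_iff_sub_mem _ _).2 ?_
  exact Ideal.subset_span ⟨i, rfl⟩

/-- The universal property of `P[x_i, y_i] / (x_i y_i - ℓ_i)`. -/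
noncomputable def lift {ℓ : Fin n → P} {S : Type*} [CommRing S] (g : P →+* S)
    (v : Fin n ⊕ Fin n → S) (hv : ∀ i, v (Sum.inl i) * v (Sum.inr i) = g (ℓ i)) :
    HyperbolaRing P ℓ →+* S :=
  Ideal.Quotient.lift (hyperbolaIdeal ℓ) (MvPolynomial.eval₂Hom g v) (by
    intro a ha
    refine (Ideal.span_le (I := RingHom.ker (MvPolynomial.eval₂Hom g v))).2 ?_ ha
    rintro _ ⟨i, rfl⟩
    simp [RingHom.mem_ker, hv])

section lift

variable {ℓ : Fin n → P} {S : Type*} [CommRing S] (g : P →+* S)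
    (v : Fin n ⊕ Fin n → S) (hv : ∀ i, v (Sum.inl i) * v (Sum.inr i) = g (ℓ i))

@[simp] theorem lift_of (p : P) : lift g v hv (of ℓ p) = g p := by
  exact MvPolynomial.eval₂_C g v p

@[simp] theorem lift_var (s : Fin n ⊕ Fin n) : lift g v hv (var ℓ s) = v s := by
  exact MvPolynomial.eval₂_X g v s

theorem hom_ext {g h : HyperbolaRing P ℓ →+* S} (h1 : ∀ p, g (of ℓ p) = h (of ℓ p))
    (h2 : ∀ s, g (var ℓ s) = h (var ℓ s)) : g = h := by
  have : g.comp (mk ℓ) = h.comp (mk ℓ) := MvPolynomial.ringHom_ext h1 h2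
  exact Ideal.Quotient.ringHom_ext this

end lift

theorem induction {ℓ : Fin n → P} (M : HyperbolaRing P ℓ → Prop) (one : M 1)
    (add : ∀ c d, M c → M d → M (c + d)) (scalar : ∀ b c, M c → M (of ℓ b * c))
    (var_mul : ∀ s c, M c → M (var ℓ s * c)) (c : HyperbolaRing P ℓ) : M c := by
  obtain ⟨p, rfl⟩ : ∃ p, mk ℓ p = c := Ideal.Quotient.mk_surjective c
  induction p using MvPolynomial.induction_on with
  | C a =>
    change M (of ℓ a)
    simpa using scalar a 1 one
  | add p q hp hq => simpa using add _ _ hp hq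
  | mul_X p s hp =>
    rw [map_mul, mul_comm]
    exact var_mul s _ hp

/-- The ring without variables is the base. -/
noncomputable def zeroEquiv (ℓ : Fin 0 → P) : P ≃+* HyperbolaRing P ℓ :=
  RingEquiv.ofRingHom (of ℓ) (lift (RingHom.id P) (Sum.elim (fun i => i.elim0) (fun i => i.elim0))
    fun i => i.elim0)
    (hom_ext (by simp) (by rintro (s | s) <;> exact s.elim0))
    (RingHom.ext (by simp))

/-- The inclusion of the ring in all variables but the first pair. -/
noncomputable def succHom (ℓ : Fin (n + 1) → P) :
    HyperbolaRing P (fun i => ℓ (Fin.succ i)) →+* HyperbolaRing P ℓ :=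
  lift (of ℓ) (fun s => var ℓ (Sum.map Fin.succ Fin.succ s)) (fun i => var_mul_var ℓ i.succ)

@[simp] theorem succHom_of (ℓ : Fin (n + 1) → P) (p : P) : succHom ℓ (of _ p) = of ℓ p :=
  lift_of _ _ _ _

@[simp] theorem succHom_var (ℓ : Fin (n + 1) → P) (s : Fin n ⊕ Fin n) :
    succHom ℓ (var _ s) = var ℓ (Sum.map Fin.succ Fin.succ s) :=
  lift_var _ _ _ _

theorem eq_of_succHom {ℓ : Fin (n + 1) → P} {S : Type*} [CommRing S] {g : HyperbolaRing P ℓ →+* S}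
    {h : HyperbolaRing P (fun i => ℓ (Fin.succ i)) →+* S} (h1 : ∀ p, g (of ℓ p) = h (of _ p))
    (h2 : ∀ s, g (var ℓ (Sum.map Fin.succ Fin.succ s)) = h (var _ s)) (b) :
    g (succHom ℓ b) = h b :=
  RingHom.congr_fun (f := g.comp (succHom ℓ)) (hom_ext (by simpa using h1) (by simpa using h2)) b

/-- This is the inductive step for every property of the tower: in each chart the other pairs are
constants and the first pair is `T, ℓ₀ T⁻¹` in one of the two orders. -/
theorem isHyperbola_succHom (ℓ : Fin (n + 1) → P) :
    IsHyperbola (succHom ℓ) (of _ (ℓ 0)) (var ℓ (Sum.inl 0)) (var ℓ (Sum.inr 0)) where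
  mul_eq := by simp [var_mul_var]
  induction M one add scalar left right c := by
    refine HyperbolaRing.induction M one add ?_ ?_ c
    · intro b c hc
      simpa using scalar (of _ b) c hc
    · rintro (s | s) c hc
      · refine Fin.cases (left c hc) (fun i => ?_) s
        simpa using scalar (var _ (Sum.inl i)) c hc
      · refine Fin.cases (right c hc) (fun i => ?_) s
        simpa using scalar (var _ (Sum.inr i)) c hc
  exists_left := by
    let ℓ' : Fin n → P := fun i => ℓ (Fin.succ i)
    refine ⟨lift (LaurentPolynomial.C.comp (of ℓ')) (Sum.elim
      (Fin.cons (T 1) fun i => LaurentPolynomial.C (var ℓ' (Sum.inl i)))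
      (Fin.cons (LaurentPolynomial.C (of ℓ' (ℓ 0)) * T (-1))
        fun i => LaurentPolynomial.C (var ℓ' (Sum.inr i)))) ?_, ?_, ?_, ?_⟩
    · intro i
      refine Fin.cases ?_ (fun i => ?_) i
      · simp only [Sum.elim_inl, Sum.elim_inr, Fin.cons_zero, RingHom.comp_apply]
        rw [mul_left_comm, ← T_add]
        simp
      · simp only [Sum.elim_inl, Sum.elim_inr, Fin.cons_succ, RingHom.comp_apply]
        rw [← map_mul, var_mul_var]
    · refine eq_of_succHom ?_ ?_
      · simp [ℓ']
      · rintro (s | s) <;> simp <;> rfl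
    · simp
    · simp
      rfl
  exists_right := by
    let ℓ' : Fin n → P := fun i => ℓ (Fin.succ i)
    refine ⟨lift (LaurentPolynomial.C.comp (of ℓ')) (Sum.elim
      (Fin.cons (LaurentPolynomial.C (of ℓ' (ℓ 0)) * T (-1))
        fun i => LaurentPolynomial.C (var ℓ' (Sum.inl i)))
      (Fin.cons (T 1) fun i => LaurentPolynomial.C (var ℓ' (Sum.inr i)))) ?_, ?_, ?_, ?_⟩
    · intro i
      refine Fin.cases ?_ (fun i => ?_) i
      · simp only [Sum.elim_inl, Sum.elim_inr, Fin.cons_zero, RingHom.comp_apply]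
        rw [mul_assoc, ← T_add]
        simp
      · simp only [Sum.elim_inl, Sum.elim_inr, Fin.cons_succ, RingHom.comp_apply]
        rw [← map_mul, var_mul_var]
    · refine eq_of_succHom ?_ ?_
      · simp [ℓ']
      · rintro (s | s) <;> simp <;> rfl
    · simp
    · simp
      rfl

theorem isReduced [IsReduced P] (ℓ : Fin n → P) : IsReduced (HyperbolaRing P ℓ) := by
  induction n with
  | zero => exact isReduced_of_injective (zeroEquiv ℓ).symm (zeroEquiv ℓ).symm.injective
  | succ n ih =>
    have := ih fun i => ℓ i.succ
    exact (isHyperbola_succHom ℓ).isReduced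

/-- Ensures that a nonzero `ℓ_i` in a domain `P` stays nonzero at the level of the tower where it
defines a hyperbola. -/
theorem of_mem_nonZeroDivisors (ℓ : Fin n → P) {p : P} (hp : p ∈ nonZeroDivisors P) :
    of ℓ p ∈ nonZeroDivisors (HyperbolaRing P ℓ) := by
  induction n with
  | zero =>
    refine mem_nonZeroDivisors_iff_right.2 fun c hc => ?_
    rw [← map_eq_zero_iff (zeroEquiv ℓ).symm (zeroEquiv ℓ).symm.injective]
    refine mem_nonZeroDivisors_iff_right.1 hp _ ?_
    rw [← map_eq_zero_iff (zeroEquiv ℓ) (zeroEquiv ℓ).injective, map_mul,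
      RingEquiv.apply_symm_apply]
    exact hc
  | succ n ih =>
    have := (isHyperbola_succHom ℓ).map_mem_nonZeroDivisors (ih fun i => ℓ i.succ)
    simpa using this

theorem isDomain_and_isIntegrallyClosed [IsDomain P] [IsIntegrallyClosed P] (ℓ : Fin n → P)
    (hℓ : ∀ i, ℓ i ≠ 0) :
    IsDomain (HyperbolaRing P ℓ) ∧ IsIntegrallyClosed (HyperbolaRing P ℓ) := by
  induction n with
  | zero =>
    exact ⟨(zeroEquiv ℓ).symm.injective.isDomain (zeroEquiv ℓ).symm.toRingHom,
      IsIntegrallyClosed.of_equiv (zeroEquiv ℓ)⟩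
  | succ n ih =>
    obtain ⟨h1, h2⟩ := ih (fun i => ℓ i.succ) fun i => hℓ _
    have h3 : of (fun i : Fin n => ℓ i.succ) (ℓ 0) ≠ 0 := nonZeroDivisors.ne_zero
      (of_mem_nonZeroDivisors _ (mem_nonZeroDivisors_of_ne_zero (hℓ 0)))
    exact ⟨(isHyperbola_succHom ℓ).isDomain h3, (isHyperbola_succHom ℓ).isIntegrallyClosed h3⟩

theorem ringKrullDim_eq [IsNoetherianRing P] (ℓ : Fin n → P) :
    ringKrullDim (HyperbolaRing P ℓ) = ringKrullDim P + n := by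
  induction n with
  | zero => simpa using (ringKrullDim_eq_of_ringEquiv (zeroEquiv ℓ)).symm
  | succ n ih =>
    rw [(isHyperbola_succHom ℓ).ringKrullDim_eq, ih, add_assoc]
    norm_cast

end HyperbolaRing

/-! ### The ring of the quadrics `∑ w_i x_i y_i` as a tower over `K[u]`. -/

namespace TorusNullFiber

variable {K : Type*} [Field K] {n d : ℕ}

/-- The polynomial `∑ i, w_i x_i y_i`. -/
noncomputable def quad : (Fin n → K) →ₗ[K] MvPolynomial (Fin n ⊕ Fin n) K :=
  Fintype.linearCombination K
    fun i => MvPolynomial.X (Sum.inl i) * MvPolynomial.X (Sum.inr i)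

theorem quad_apply (w : Fin n → K) : quad w =
    ∑ i, MvPolynomial.C (w i) * (MvPolynomial.X (Sum.inl i) * MvPolynomial.X (Sum.inr i)) := by
  simp [quad, Fintype.linearCombination_apply, MvPolynomial.smul_eq_C_mul]

/-- The ideal generated by the polynomials `∑ i, w_i x_i y_i` with `w ∈ W`. -/
noncomputable def quadIdeal (W : Submodule K (Fin n → K)) :
    Ideal (MvPolynomial (Fin n ⊕ Fin n) K) :=
  Ideal.span (quad '' W)

/-- The linear form `∑ j, v_j u_j`. -/
noncomputable def linForm : (Fin d → K) →ₗ[K] MvPolynomial (Fin d) K :=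
  Fintype.linearCombination K MvPolynomial.X

theorem linForm_single (j : Fin d) : linForm (Pi.single j (1 : K)) = MvPolynomial.X j := by
  simp [linForm]

theorem linForm_injective : Function.Injective (linForm : (Fin d → K) → _) := by
  exact LinearIndependent.fintypeLinearCombination_injective (MvPolynomial.linearIndependent_X (Fin d) K)

section equiv

variable (W : Submodule K (Fin n → K)) (π : (Fin n → K) →ₗ[K] (Fin d → K))
  (σ : (Fin d → K) →ₗ[K] (Fin n → K))

/-- The coordinate forms on the linear space with equations `W`. -/
noncomputable def coordForm (i : Fin n) : MvPolynomial (Fin d) K := linForm (π (Pi.single i 1))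

theorem linForm_apply_eq_sum (w : Fin n → K) :
    linForm (π w) = ∑ i, MvPolynomial.C (w i) * coordForm π i := by
  conv_lhs => rw [← Finset.univ_sum_single w]
  simp only [map_sum, coordForm]
  refine Finset.sum_congr rfl fun i _ => ?_
  rw [← MvPolynomial.smul_eq_C_mul, ← map_smul, ← map_smul]
  congr 2
  ext j
  simp [Pi.single_apply]

theorem coordForm_ne_zero_iff (hker : LinearMap.ker π = W) (i : Fin n) :
    coordForm π i ≠ 0 ↔ Pi.single i 1 ∉ W := by
  rw [← hker, LinearMap.mem_ker, coordForm, Ne, map_eq_zero_iff _ linForm_injective]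

/-- The coordinates of `V ⊕ V*`, mapped to those of `K[u][x, y] / (x_i y_i - ℓ_i(u))`. -/
noncomputable def polyToHyperbola :
    MvPolynomial (Fin n ⊕ Fin n) K →+* HyperbolaRing (MvPolynomial (Fin d) K) (coordForm π) :=
  MvPolynomial.eval₂Hom ((HyperbolaRing.of (coordForm π)).comp MvPolynomial.C)
    (HyperbolaRing.var (coordForm π))

theorem polyToHyperbola_quad (w : Fin n → K) :
    polyToHyperbola π (quad w) = HyperbolaRing.of (coordForm π) (linForm (π w)) := by
  rw [linForm_apply_eq_sum, quad_apply]
  simp [polyToHyperbola, HyperbolaRing.var_mul_var]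

/-- The comparison map from `K[x, y] / (∑ w_i x_i y_i | w ∈ W)` to
`K[u][x, y] / (x_i y_i - ℓ_i(u))`. -/
noncomputable def quotToHyperbola (hker : LinearMap.ker π = W) :
    (MvPolynomial (Fin n ⊕ Fin n) K ⧸ quadIdeal W) →+* HyperbolaRing (MvPolynomial (Fin d) K)
      (coordForm π) :=
  Ideal.Quotient.lift _ (polyToHyperbola π) (by
    intro a ha
    refine (Ideal.span_le (I := RingHom.ker _)).2 ?_ ha
    rintro _ ⟨w, hw, rfl⟩
    rw [← hker, SetLike.mem_coe, LinearMap.mem_ker] at hw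
    rw [SetLike.mem_coe, RingHom.mem_ker, polyToHyperbola_quad, hw, map_zero, map_zero])

theorem quotToHyperbola_mk (hker : LinearMap.ker π = W) (p : MvPolynomial (Fin n ⊕ Fin n) K) :
    quotToHyperbola W π hker (Ideal.Quotient.mk _ p) = polyToHyperbola π p := rfl

/-- The parameters `u_j` as functions on the null fibre. -/
noncomputable def paramHom : MvPolynomial (Fin d) K →+*
    (MvPolynomial (Fin n ⊕ Fin n) K ⧸ quadIdeal W) :=
  MvPolynomial.eval₂Hom ((Ideal.Quotient.mk _).comp MvPolynomial.C)
    fun j => Ideal.Quotient.mk _ (quad (σ (Pi.single j 1)))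

theorem paramHom_linForm (u : Fin d → K) :
    paramHom W σ (linForm u) = Ideal.Quotient.mk _ (quad (σ u)) := by
  conv_rhs => rw [← Finset.univ_sum_single u]
  simp only [linForm, Fintype.linearCombination_apply, map_sum]
  refine Finset.sum_congr rfl fun j _ => ?_
  rw [show (Pi.single j (u j) : Fin d → K) = u j • Pi.single j 1 by
    ext k; simp [Pi.single_apply], map_smul σ, map_smul quad, MvPolynomial.smul_eq_C_mul,
    MvPolynomial.smul_eq_C_mul, map_mul, map_mul]
  simp [paramHom]

/-- `K[x, y] / (∑ w_i x_i y_i | w ∈ W)` is `K[u][x, y] / (x_i y_i - ℓ_i(u))`. -/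
noncomputable def quotEquiv (hπσ : ∀ u, π (σ u) = u) (hker : LinearMap.ker π = W) :
    (MvPolynomial (Fin n ⊕ Fin n) K ⧸ quadIdeal W) ≃+* HyperbolaRing (MvPolynomial (Fin d) K)
      (coordForm π) :=
  RingEquiv.ofRingHom (quotToHyperbola W π hker)
    (HyperbolaRing.lift (paramHom W σ) (fun s => Ideal.Quotient.mk _ (MvPolynomial.X s)) (by
      intro i
      rw [coordForm, paramHom_linForm, ← map_mul, Ideal.Quotient.mk_eq_mk_iff_sub_mem]
      have h1 : (MvPolynomial.X (Sum.inl i) * MvPolynomial.X (Sum.inr i) :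
          MvPolynomial (Fin n ⊕ Fin n) K) = quad (Pi.single i 1) := by simp [quad]
      rw [h1, ← map_sub]
      -- The difference is `quad` of `e_i - σ (π e_i)`, a vector of `ker π = W`.
      refine Ideal.subset_span ⟨_, ?_, rfl⟩
      rw [← hker, SetLike.mem_coe, LinearMap.mem_ker, map_sub, hπσ, sub_self]))
    (by
      refine HyperbolaRing.hom_ext (fun p => ?_) (fun s => ?_)
      · have h : ∀ F : HyperbolaRing (MvPolynomial (Fin d) K) (coordForm π) →+*
            HyperbolaRing (MvPolynomial (Fin d) K) (coordForm π),
            (∀ a, F (HyperbolaRing.of _ (MvPolynomial.C a)) =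
              HyperbolaRing.of _ (MvPolynomial.C a)) →
            (∀ j, F (HyperbolaRing.of _ (MvPolynomial.X j)) =
              HyperbolaRing.of _ (MvPolynomial.X j)) →
            F (HyperbolaRing.of _ p) = HyperbolaRing.of _ p :=
          fun F h1 h2 => RingHom.congr_fun (f := F.comp (HyperbolaRing.of _))
            (MvPolynomial.ringHom_ext h1 h2) p
        refine h _ ?_ ?_
        · intro a
          simp [quotToHyperbola_mk, paramHom, polyToHyperbola]
        · intro j
          simp only [RingHom.comp_apply, HyperbolaRing.lift_of, paramHom,
            MvPolynomial.coe_eval₂Hom, MvPolynomial.eval₂_X, quotToHyperbola_mk]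
          rw [polyToHyperbola_quad, hπσ, linForm_single]
      · simp [quotToHyperbola_mk, polyToHyperbola])
    (by
      apply Ideal.Quotient.ringHom_ext
      apply MvPolynomial.ringHom_ext
      · intro a
        simp [quotToHyperbola_mk, paramHom, polyToHyperbola]
      · intro s
        simp [quotToHyperbola_mk, polyToHyperbola])

end equiv

theorem exists_split (W : Submodule K (Fin n → K)) :
    ∃ (d : ℕ) (π : (Fin n → K) →ₗ[K] (Fin d → K)) (σ : (Fin d → K) →ₗ[K] (Fin n → K)),
      (∀ u, π (σ u) = u) ∧ LinearMap.ker π = W ∧ d + Module.finrank K W = n := by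
  let e := (Module.finBasis K ((Fin n → K) ⧸ W)).equivFun
  let π := e.toLinearMap ∘ₗ W.mkQ
  have hπ : Function.Surjective π := e.surjective.comp W.mkQ_surjective
  obtain ⟨σ, hσ⟩ := π.exists_rightInverse_of_surjective (LinearMap.range_eq_top.2 hπ)
  refine ⟨_, π, σ, fun u => LinearMap.congr_fun hσ u, ?_, ?_⟩
  · rw [LinearMap.ker_comp]
    simp
  · simpa using W.finrank_quotient_add_finrank

section facts

variable (W : Submodule K (Fin n → K))

theorem isReduced_quot : IsReduced (MvPolynomial (Fin n ⊕ Fin n) K ⧸ quadIdeal W) := by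
  obtain ⟨d, π, σ, h1, h2, -⟩ := exists_split W
  have := HyperbolaRing.isReduced (coordForm π)
  exact isReduced_of_injective (quotEquiv W π σ h1 h2) (quotEquiv W π σ h1 h2).injective

theorem isRadical_quadIdeal : (quadIdeal W).IsRadical :=
  (Ideal.isRadical_iff_quotient_reduced _).2 (isReduced_quot W)

/-- The tower contributes `d` parameters and one dimension for each of the `n` pairs, with `d = n -
dim W`. -/
theorem ringKrullDim_quot :
    ringKrullDim (MvPolynomial (Fin n ⊕ Fin n) K ⧸ quadIdeal W) + (Module.finrank K W : ℕ) =
      ((2 * n : ℕ) : WithBot ℕ∞) := by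
  obtain ⟨d, π, σ, h1, h2, h3⟩ := exists_split W
  rw [ringKrullDim_eq_of_ringEquiv (quotEquiv W π σ h1 h2), HyperbolaRing.ringKrullDim_eq,
    MvPolynomial.ringKrullDim_of_isNoetherianRing, ringKrullDim_eq_zero_of_field]
  rw [zero_add, two_mul]
  conv_rhs => rw [← h3]
  simp only [Nat.card_eq_fintype_card, Fintype.card_fin]
  norm_cast
  omega

/-- The variable `x_i` divides `x_i y_i = ℓ_i`, which is a nonzero element of `K[u]` and so regular
in the tower. -/
theorem X_mul_mem_quadIdeal {i : Fin n} (hi : Pi.single i 1 ∉ W)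
    {p : MvPolynomial (Fin n ⊕ Fin n) K} (hp : MvPolynomial.X (Sum.inl i) * p ∈ quadIdeal W) :
    p ∈ quadIdeal W := by
  obtain ⟨d, π, σ, h1, h2, -⟩ := exists_split W
  rw [← Ideal.Quotient.eq_zero_iff_mem] at hp ⊢
  let E := quotEquiv W π σ h1 h2
  rw [← map_eq_zero_iff E E.injective] at hp ⊢
  have hX : E (Ideal.Quotient.mk _ (MvPolynomial.X (Sum.inl i))) =
      HyperbolaRing.var (coordForm π) (Sum.inl i) := by
    change polyToHyperbola π _ = _
    simp [polyToHyperbola]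
  rw [map_mul, map_mul, hX] at hp
  have := HyperbolaRing.of_mem_nonZeroDivisors (coordForm π)
    (mem_nonZeroDivisors_of_ne_zero ((coordForm_ne_zero_iff W π h2 i).2 hi))
  refine (mul_left_mem_nonZeroDivisors_eq_zero_iff this).1 ?_
  rw [← HyperbolaRing.var_mul_var, mul_right_comm, hp, zero_mul]

theorem isDomain_and_isIntegrallyClosed_quot (hW : ∀ i, Pi.single i 1 ∉ W) :
    IsDomain (MvPolynomial (Fin n ⊕ Fin n) K ⧸ quadIdeal W) ∧
      IsIntegrallyClosed (MvPolynomial (Fin n ⊕ Fin n) K ⧸ quadIdeal W) := by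
  obtain ⟨d, π, σ, h1, h2, -⟩ := exists_split W
  let E := quotEquiv W π σ h1 h2
  obtain ⟨h3, h4⟩ := HyperbolaRing.isDomain_and_isIntegrallyClosed (coordForm π)
    fun i => (coordForm_ne_zero_iff W π h2 i).2 (hW i)
  exact ⟨E.injective.isDomain E.toRingHom, IsIntegrallyClosed.of_equiv E.symm⟩

end facts

end TorusNullFiber

/-! ### Ranks of row submatrices in terms of the column space. -/

namespace TorusNullFiber

variable {K : Type*} [Field K] {n r : ℕ}

/-- The column space of an integral matrix over `K`. -/
noncomputable def colSpace (K : Type*) [Field K] (S : Matrix (Fin n) (Fin r) ℤ) :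
    Submodule K (Fin n → K) :=
  LinearMap.range (S.map (Int.cast : ℤ → K)).mulVecLin

theorem rowRank_eq (S : Matrix (Fin n) (Fin r) ℤ) (I : Finset (Fin n)) :
    rowRank K S I = Module.finrank K
      ((colSpace K S).map (LinearMap.funLeft K K (Subtype.val : I → Fin n))) := by
  rw [rowRank, Matrix.rank, colSpace, ← LinearMap.range_comp]
  rfl

theorem finrank_ker_funLeft (I : Finset (Fin n)) :
    I.card + Module.finrank K (LinearMap.ker (LinearMap.funLeft K K (Subtype.val : I → Fin n))) =
      n := by
  have h := LinearMap.finrank_range_add_finrank_ker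
    (LinearMap.funLeft K K (Subtype.val : I → Fin n))
  rw [LinearMap.range_eq_top.2 (LinearMap.funLeft_surjective_of_injective K K _
    Subtype.val_injective), finrank_top] at h
  simpa using h

/-- Rank-nullity for the restriction of the column space to the coordinates in `I`. -/
theorem rowRank_add (S : Matrix (Fin n) (Fin r) ℤ) (I : Finset (Fin n)) :
    rowRank K S I + Module.finrank K (colSpace K S ⊓
      LinearMap.ker (LinearMap.funLeft K K (Subtype.val : I → Fin n)) : Submodule K (Fin n → K)) =
      Module.finrank K (colSpace K S) := by
  let g := LinearMap.funLeft K K (Subtype.val : I → Fin n)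
  have h := LinearMap.finrank_range_add_finrank_ker (g.domRestrict (colSpace K S))
  rw [LinearMap.range_domRestrict, LinearMap.ker_domRestrict] at h
  rw [rowRank_eq, ← h, ← Submodule.map_comap_subtype]
  congr 1
  exact Submodule.finrank_map_subtype_eq _ _

theorem rowRank_univ (S : Matrix (Fin n) (Fin r) ℤ) :
    rowRank K S Finset.univ = Module.finrank K (colSpace K S) := by
  rw [← rowRank_add S Finset.univ, left_eq_add, Submodule.finrank_eq_zero, eq_bot_iff]
  rintro w ⟨-, hw⟩
  ext i
  exact congrFun hw ⟨i, Finset.mem_univ i⟩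

/-- The kernel is spanned by the `e_i` with `i ∉ I`. -/
theorem ker_funLeft_le_iff (W : Submodule K (Fin n → K)) (I : Finset (Fin n)) :
    LinearMap.ker (LinearMap.funLeft K K (Subtype.val : I → Fin n)) ≤ W ↔
      ∀ i, Pi.single i 1 ∉ W → i ∈ I := by
  constructor
  · intro h i hi
    by_contra hI
    refine hi (h ?_)
    ext j
    have : (j : Fin n) ≠ i := fun e => hI (e ▸ j.2)
    simp [LinearMap.funLeft_apply, this]
  · intro h w hw
    rw [← Finset.univ_sum_single w]
    refine Submodule.sum_mem _ fun i _ => ?_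
    by_cases hi : i ∈ I
    · have : w i = 0 := congrFun hw ⟨i, hi⟩
      simp [this]
    · have h1 : (Pi.single i 1 : Fin n → K) ∈ W := by
        by_contra h2
        exact hi (h i h2)
      have := W.smul_mem (w i) h1
      rwa [← Pi.single_smul, smul_eq_mul, mul_one] at this

/-- The rank condition on `I` says that the coordinate forms outside of `I` vanish. -/
theorem rowRank_sub_eq_iff (S : Matrix (Fin n) (Fin r) ℤ) (I : Finset (Fin n)) :
    (rowRank K S Finset.univ : ℤ) - rowRank K S I = n - I.card ↔
      ∀ i, Pi.single i 1 ∉ colSpace K S → i ∈ I := by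
  have h1 := rowRank_add (K := K) S I
  have h2 := finrank_ker_funLeft (K := K) I
  rw [rowRank_univ, ← ker_funLeft_le_iff]
  constructor
  · intro h
    rw [← inf_eq_right]
    -- By `h1` and `h2` the rank equation says that the intersection has the dimension `n - #I` of
    -- the whole kernel.
    refine Submodule.eq_of_le_of_finrank_eq inf_le_right ?_
    omega
  · intro h
    rw [← inf_eq_right] at h
    rw [h] at h1
    omega

/-- Dropping row `i` loses rank exactly when the column space meets the line `K e_i` nontrivially.
-/
theorem rowRank_erase_eq_iff (S : Matrix (Fin n) (Fin r) ℤ) (i : Fin n) :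
    rowRank K S (Finset.univ.erase i) = rowRank K S Finset.univ ↔
      Pi.single i 1 ∉ colSpace K S := by
  rw [rowRank_univ, ← rowRank_add S (Finset.univ.erase i), left_eq_add,
    Submodule.finrank_eq_zero, eq_bot_iff]
  constructor
  · intro h hi
    have h1 : (Pi.single i 1 : Fin n → K) ∈ (⊥ : Submodule K (Fin n → K)) := by
      refine h ⟨hi, ?_⟩
      ext j
      have : (j : Fin n) ≠ i := Finset.ne_of_mem_erase j.2
      simp [LinearMap.funLeft_apply, this]
    simpa using congrFun ((Submodule.mem_bot K).1 h1) i
  · rintro h w ⟨hw, hk⟩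
    have hk' : ∀ j, j ≠ i → w j = 0 := fun j hj =>
      congrFun hk ⟨j, Finset.mem_erase.2 ⟨hj, Finset.mem_univ j⟩⟩
    have hws : w = w i • Pi.single i 1 := by
      ext j
      rcases eq_or_ne j i with rfl | hj
      · simp
      · simp [hk' j hj, hj]
    by_cases hi : w i = 0
    · rw [hws, hi, zero_smul]
      exact zero_mem _
    · refine (h ?_).elim
      rw [hws] at hw
      exact (Submodule.smul_mem_iff _ hi).1 hw

/-! ### The Lie algebra of the torus and the equations of the moment map. -/

section moment

variable {A V : Type*} [CommRing A] [HopfAlgebra K A] [AddCommGroup V] [Module K V]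
  (e : A ≃ₐc[K] AddMonoidAlgebra K (Fin r → ℤ))

/-- The character of the torus `Spec A` given by `m`, as a function. -/
noncomputable def character (m : Fin r → ℤ) : A := e.symm (AddMonoidAlgebra.single m 1)

theorem character_add (m m' : Fin r → ℤ) :
    character e (m + m') = character e m * character e m' := by
  rw [character, character, character, ← map_mul, AddMonoidAlgebra.single_mul_single, one_mul]

theorem counit_character (m : Fin r → ℤ) :
    Coalgebra.counit (R := K) (character e m) = 1 := by
  simp [character]

/-- Characters have counit one, so the Leibniz rule makes `D` additive in the exponent. -/
theorem lieSpace_apply_character (D : lieSpace K A) (m : Fin r → ℤ) :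
    (D : Module.Dual K A) (character e m) =
      ∑ j, (m j : K) * (D : Module.Dual K A) (character e (Pi.single j 1)) := by
  have hadd : ∀ m m', (D : Module.Dual K A) (character e (m + m')) =
      (D : Module.Dual K A) (character e m) + (D : Module.Dual K A) (character e m') := by
    intro m m'
    rw [character_add, D.2, counit_character, counit_character]
    ring
  let χ : (Fin r → ℤ) →+ K :=
    { toFun := fun m => (D : Module.Dual K A) (character e m)
      map_zero' := by simpa using hadd 0 0
      map_add' := hadd }
  have hm : m = ∑ j, m j • (Pi.single j 1 : Fin r → ℤ) := by
    ext k
    simp [Finset.sum_apply, Pi.single_apply]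
  change χ m = ∑ j, (m j : K) * χ (Pi.single j 1)
  conv_lhs => rw [hm]
  rw [map_sum]
  exact Finset.sum_congr rfl fun j _ => by rw [map_zsmul, zsmul_eq_mul]

/-- Characters form a basis of `A`, so `D` may be prescribed on them, and the Leibniz rule, being
bilinear, need only be checked on pairs of characters. -/
theorem exists_lieSpace (d : Fin r → K) :
    ∃ D : lieSpace K A, ∀ j, (D : Module.Dual K A) (character e (Pi.single j 1)) = d j := by
  let B : Module.Basis (Fin r → ℤ) K A :=
    (Module.Basis.ofRepr (AddMonoidAlgebra.coeffLinearEquiv K)).map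
      (e.symm.toLinearEquiv : AddMonoidAlgebra K (Fin r → ℤ) ≃ₗ[K] A)
  have hB : ∀ m, B m = character e m := fun m => rfl
  let D : Module.Dual K A := B.constr K fun m => ∑ j, (m j : K) * d j
  have hD : ∀ m, D (character e m) = ∑ j, (m j : K) * d j := by
    intro m
    rw [← hB]
    exact B.constr_basis K _ m
  refine ⟨⟨D, ?_⟩, fun j => ?_⟩
  · have key : (LinearMap.mul K A).compr₂ D =
        (LinearMap.mul K K).compl₁₂ (Coalgebra.counit (R := K) (A := A)) D +
        (LinearMap.mul K K).compl₁₂ D (Coalgebra.counit (R := K) (A := A)) := by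
      refine B.ext fun m => B.ext fun m' => ?_
      simp only [hB, LinearMap.compr₂_apply, LinearMap.mul_apply', LinearMap.add_apply,
        LinearMap.compl₁₂_apply, counit_character, ← character_add, hD]
      simp [add_mul, Finset.sum_add_distrib, add_comm]
    intro f g
    exact LinearMap.congr_fun (LinearMap.congr_fun key f) g
  · rw [hD]
    simp [Pi.single_apply]

variable {e} {ρ : RationalRep K A V} {b : Module.Basis (Fin n) K V}
  {S : Matrix (Fin n) (Fin r) ℤ}

theorem momentPoly_eq (hS : ρ.IsWeightBasis e b S) (D : lieSpace K A) :
    ρ.momentPoly b D = quad ((S.map (Int.cast : ℤ → K)).mulVecLin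
      fun j => (D : Module.Dual K A) (character e (Pi.single j 1))) := by
  have hact : ∀ k, ρ.lieAct D (b k) = (D : Module.Dual K A) (character e (S k)) • b k := by
    intro k
    simp [RationalRep.lieAct, hS k, character]
  rw [RationalRep.momentPoly, quad_apply]
  refine Finset.sum_congr rfl fun i _ => ?_
  rw [Finset.sum_eq_single i]
  · rw [hact, lieSpace_apply_character]
    simp [Matrix.mulVec, dotProduct, mul_assoc]
  · intro k _ hk
    simp [hact, hk]
  · simp

/-- The Lie algebra acts diagonally by the pairing with the weights, and its elements realize every
vector of `K^r`; the equations therefore run through the whole column space. -/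
theorem nullIdeal_eq (hS : ρ.IsWeightBasis e b S) :
    ρ.nullIdeal b = quadIdeal (colSpace K S) := by
  rw [RationalRep.nullIdeal, quadIdeal]
  congr 1
  ext f
  constructor
  · rintro ⟨D, rfl⟩
    exact ⟨_, ⟨_, rfl⟩, (momentPoly_eq hS D).symm⟩
  · rintro ⟨_, ⟨d, rfl⟩, rfl⟩
    obtain ⟨D, hD⟩ := exists_lieSpace (A := A) e d
    exact ⟨D, by rw [momentPoly_eq hS, funext hD]⟩

end moment

end TorusNullFiber

/-! ### Strata of the fibre and minimal primes. -/

namespace TorusNullFiber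

variable {K : Type*} [Field K] {n d : ℕ} (W : Submodule K (Fin n → K))

/-- The points of the zero fibre of the moment map, in coordinates. -/
def nullPoints : Set (Fin n ⊕ Fin n → K) :=
  {p | ∀ w ∈ W, ∑ i, w i * (p (Sum.inl i) * p (Sum.inr i)) = 0}

theorem eval_quad (w : Fin n → K) (p : Fin n ⊕ Fin n → K) :
    MvPolynomial.eval p (quad w) = ∑ i, w i * (p (Sum.inl i) * p (Sum.inr i)) := by
  simp [quad_apply]

theorem mem_nullPoints_iff (p : Fin n ⊕ Fin n → K) :
    p ∈ nullPoints W ↔ ∀ f ∈ quadIdeal W, MvPolynomial.eval p f = 0 := by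
  constructor
  · intro hp f hf
    refine (Ideal.span_le (I := RingHom.ker (MvPolynomial.eval p))).2 ?_ hf
    rintro _ ⟨w, hw, rfl⟩
    rw [SetLike.mem_coe, RingHom.mem_ker, eval_quad]
    exact hp w hw
  · intro h w hw
    rw [← eval_quad]
    exact h _ (Ideal.subset_span ⟨w, hw, rfl⟩)

/-- The Nullstellensatz, with no radical needed because the quotient is reduced. -/
theorem mem_quadIdeal_of_eval [IsAlgClosed K] {f : MvPolynomial (Fin n ⊕ Fin n) K}
    (hf : ∀ p ∈ nullPoints W, MvPolynomial.eval p f = 0) : f ∈ quadIdeal W := by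
  rw [← (isRadical_quadIdeal W).radical,
    ← MvPolynomial.vanishingIdeal_zeroLocus_eq_radical (K := K)]
  intro p hp
  rw [MvPolynomial.aeval_eq_eval]
  refine hf p ((mem_nullPoints_iff W p).2 fun g hg => ?_)
  rw [← MvPolynomial.aeval_eq_eval]
  exact hp g hg

/-- The polynomials vanishing at the points of the zero fibre over the stratum `J_I`. -/
noncomputable def stratumIdeal (I : Finset (Fin n)) : Ideal (MvPolynomial (Fin n ⊕ Fin n) K) :=
  ⨅ p ∈ {p ∈ nullPoints W | ∀ i, p (Sum.inl i) ≠ 0 ↔ i ∈ I}, RingHom.ker (MvPolynomial.eval p)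

variable {W}

theorem mem_stratumIdeal {I : Finset (Fin n)} {f : MvPolynomial (Fin n ⊕ Fin n) K} :
    f ∈ stratumIdeal W I ↔ ∀ p ∈ nullPoints W, (∀ i, p (Sum.inl i) ≠ 0 ↔ i ∈ I) →
      MvPolynomial.eval p f = 0 := by
  simp [stratumIdeal, RingHom.mem_ker]

theorem quadIdeal_le_stratumIdeal (I : Finset (Fin n)) : quadIdeal W ≤ stratumIdeal W I :=
  fun f hf => mem_stratumIdeal.2 fun p hp _ => (mem_nullPoints_iff W p).1 hp f hf

section parametrization

variable (π : (Fin n → K) →ₗ[K] (Fin d → K)) (I : Finset (Fin n))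

/-- A parametrization of the zero fibre over the stratum `J_I`: the coordinates `x_i`, `i ∈ I` are
free, `y_i = ℓ_i(u) ∏ j ∈ I \ {i}, x_j` for `i ∈ I`, and `y_i` is free for `i ∉ I`. -/
noncomputable def stratumParam :
    MvPolynomial (Fin n ⊕ Fin n) K →ₐ[K] MvPolynomial (Fin d ⊕ Fin n) K :=
  MvPolynomial.aeval (Sum.elim
    (fun i => if i ∈ I then MvPolynomial.X (Sum.inr i) else 0)
    (fun i => if i ∈ I then MvPolynomial.rename Sum.inl (coordForm π i) *
      ∏ j ∈ I.erase i, MvPolynomial.X (Sum.inr j) else MvPolynomial.X (Sum.inr i)))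

theorem eval_stratumParam (q : Fin d ⊕ Fin n → K) (f : MvPolynomial (Fin n ⊕ Fin n) K) :
    MvPolynomial.eval q (stratumParam π I f) = MvPolynomial.eval (Sum.elim
      (fun i => if i ∈ I then q (Sum.inr i) else 0)
      (fun i => if i ∈ I then MvPolynomial.eval (fun j => q (Sum.inl j)) (coordForm π i) *
        ∏ j ∈ I.erase i, q (Sum.inr j) else q (Sum.inr i))) f := by
  refine RingHom.congr_fun (f := (MvPolynomial.eval q).comp (stratumParam π I).toRingHom)
    (MvPolynomial.ringHom_ext ?_ ?_) f
  · intro a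
    simp [stratumParam]
  · rintro (i | i)
    · by_cases hi : i ∈ I <;> simp [stratumParam, hi]
    · by_cases hi : i ∈ I
      · simp [stratumParam, hi, MvPolynomial.eval_rename, Function.comp_def]
      · simp [stratumParam, hi]

variable {π I}

theorem eval_linForm (u v : Fin d → K) :
    MvPolynomial.eval u (linForm v) = ∑ j, v j * u j := by
  simp [linForm, Fintype.linearCombination_apply, MvPolynomial.smul_eq_C_mul]

/-- Where `∏ j ∈ I, x_j ≠ 0` the parametrization hits exactly the stratum. For `i ∈ I` it gives `x_i
y_i = ℓ_i(u) ∏ j ∈ I, x_j`, so rescaling `u` by the product avoids denominators. For `i ∉ I`, `ℓ_i =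
0` and `y_i` is unconstrained. -/
theorem stratumIdeal_eq_ker [Infinite K] {σ : (Fin d → K) →ₗ[K] (Fin n → K)}
    (hπσ : ∀ u, π (σ u) = u) (hker : LinearMap.ker π = W)
    (hI : ∀ i, Pi.single i 1 ∉ W → i ∈ I) :
    stratumIdeal W I = RingHom.ker (stratumParam π I) := by
  have hcoord : ∀ i, i ∉ I → coordForm π i = 0 := by
    intro i hi
    by_contra h
    exact hi (hI i ((coordForm_ne_zero_iff W π hker i).1 h))
  have hmul : ∀ (q : Fin n → K) (i : Fin n), i ∈ I → q i * ∏ j ∈ I.erase i, q j = ∏ j ∈ I, q j :=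
    fun q i hi => Finset.mul_prod_erase I q hi
  ext f
  rw [mem_stratumIdeal, RingHom.mem_ker]
  constructor
  · intro hf
    -- Multiplying by the product kills the parameters that land off the stratum, where nothing is
    -- known about `f`.
    have hprod : stratumParam π I f * ∏ i ∈ I, MvPolynomial.X (Sum.inr i) = 0 := by
      apply MvPolynomial.funext
      intro q
      rw [map_mul, map_zero, MvPolynomial.eval_prod]
      simp only [MvPolynomial.eval_X]
      by_cases h0 : ∏ i ∈ I, q (Sum.inr i) = 0
      · rw [h0, mul_zero]
      · rw [eval_stratumParam, hf _ ?_ ?_, zero_mul]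
        · intro w hw
          have hz : ∀ i, w i * (Sum.elim (fun i => if i ∈ I then q (Sum.inr i) else 0)
              (fun i => if i ∈ I then MvPolynomial.eval (fun j => q (Sum.inl j)) (coordForm π i) *
                ∏ j ∈ I.erase i, q (Sum.inr j) else q (Sum.inr i)) (Sum.inl i) *
              Sum.elim (fun i => if i ∈ I then q (Sum.inr i) else 0)
              (fun i => if i ∈ I then MvPolynomial.eval (fun j => q (Sum.inl j)) (coordForm π i) *
                ∏ j ∈ I.erase i, q (Sum.inr j) else q (Sum.inr i)) (Sum.inr i)) =
              MvPolynomial.eval (fun j => q (Sum.inl j)) (MvPolynomial.C (w i) * coordForm π i) *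
                ∏ j ∈ I, q (Sum.inr j) := by
            intro i
            by_cases hi : i ∈ I
            · simp only [Sum.elim_inl, Sum.elim_inr, hi, if_true, map_mul, MvPolynomial.eval_C]
              rw [← hmul (fun j => q (Sum.inr j)) i hi]
              ring
            · simp [hi, hcoord i hi]
          rw [Finset.sum_congr rfl fun i _ => hz i, ← Finset.sum_mul, ← map_sum,
            ← linForm_apply_eq_sum]
          rw [← hker, LinearMap.mem_ker] at hw
          rw [hw, map_zero, map_zero, zero_mul]
        · intro i
          by_cases hi : i ∈ I
          · simpa [hi] using Finset.prod_ne_zero_iff.1 h0 i hi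
          · simp [hi]
    refine (mul_eq_zero.1 hprod).resolve_right ?_
    exact Finset.prod_ne_zero_iff.2 fun i _ => MvPolynomial.X_ne_zero _
  · intro hf p hp hpI
    have hm : ∏ j ∈ I, p (Sum.inl j) ≠ 0 := Finset.prod_ne_zero_iff.2 fun i hi => (hpI i).2 hi
    let z : (Fin n → K) →ₗ[K] K :=
      Fintype.linearCombination K fun i => p (Sum.inl i) * p (Sum.inr i)
    have hz : ∀ w, z w = ∑ i, w i * (p (Sum.inl i) * p (Sum.inr i)) := fun w => by
      simp [z, Fintype.linearCombination_apply]
    have hzW : ∀ w, π w = 0 → z w = 0 := by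
      intro w hw
      rw [hz]
      exact hp w (by rw [← hker]; exact hw)
    -- The functional `z` vanishes on `W = ker π`, hence factors through `π`; `u` lists the
    -- coordinates of the factored functional.
    let u : Fin d → K := fun j => z (σ (Pi.single j 1))
    have hzσ : ∀ v, z (σ v) = ∑ j, v j * u j := by
      intro v
      conv_lhs => rw [← Finset.univ_sum_single v, map_sum, map_sum]
      refine Finset.sum_congr rfl fun j _ => ?_
      rw [show (Pi.single j (v j) : Fin d → K) = v j • Pi.single j 1 by
        ext k; simp [Pi.single_apply], map_smul, map_smul, smul_eq_mul]
    have hu : ∀ i, ∑ j, π (Pi.single i 1) j * u j = p (Sum.inl i) * p (Sum.inr i) := by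
      intro i
      rw [← hzσ]
      have h1 := hzW (σ (π (Pi.single i 1)) - Pi.single i 1) (by rw [map_sub, hπσ, sub_self])
      rw [map_sub, sub_eq_zero] at h1
      rw [h1]
      simp [z]
    -- The preimage of `p` has parameters `u` divided by `∏ j ∈ I, x_j`, undoing the rescaling.
    have h2 := eval_stratumParam π I
      (Sum.elim (fun j => u j * (∏ j ∈ I, p (Sum.inl j))⁻¹)
        (fun i => if i ∈ I then p (Sum.inl i) else p (Sum.inr i))) f
    rw [hf, map_zero] at h2
    rw [h2]
    congr 2
    funext s
    rcases s with i | i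
    · by_cases hi : i ∈ I
      · simp [hi]
      · simpa [hi] using not_not.1 (mt (hpI i).1 hi)
    · by_cases hi : i ∈ I
      · have h3 : ∏ j ∈ I.erase i, (if j ∈ I then p (Sum.inl j) else p (Sum.inr j)) =
            ∏ j ∈ I.erase i, p (Sum.inl j) :=
          Finset.prod_congr rfl fun j hj => if_pos (Finset.mem_of_mem_erase hj)
        simp only [Sum.elim_inl, Sum.elim_inr, hi, if_true, coordForm, eval_linForm, ← mul_assoc,
          ← Finset.sum_mul, hu, h3]
        have h4 := hmul (fun j => p (Sum.inl j)) i hi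
        have h5 : p (Sum.inl i) ≠ 0 := (hpI i).2 hi
        field_simp
        rw [← h4]
        ring
      · simp [hi]

end parametrization

theorem isPrime_stratumIdeal [Infinite K] {I : Finset (Fin n)}
    (hI : ∀ i, Pi.single i 1 ∉ W → i ∈ I) : (stratumIdeal W I).IsPrime := by
  obtain ⟨d, π, σ, h1, h2, -⟩ := exists_split W
  rw [stratumIdeal_eq_ker h1 h2 hI]
  exact RingHom.ker_isPrime _

/-- A point with `x_i ≠ 0` whenever `e_i ∉ W` lies on an admissible stratum. Hence `f` times the
product of these `x_i` vanishes on the whole fibre, and the factors cancel one by one as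
nonzerodivisors. -/
theorem mem_quadIdeal_of_forall_stratumIdeal [IsAlgClosed K]
    {f : MvPolynomial (Fin n ⊕ Fin n) K}
    (hf : ∀ I : Finset (Fin n), (∀ i, Pi.single i 1 ∉ W → i ∈ I) → f ∈ stratumIdeal W I) :
    f ∈ quadIdeal W := by
  classical
  have key : (∏ i ∈ Finset.univ.filter (fun i => Pi.single i 1 ∉ W), MvPolynomial.X (Sum.inl i)) *
      f ∈ quadIdeal W := by
    refine mem_quadIdeal_of_eval W fun p hp => ?_
    rw [map_mul, MvPolynomial.eval_prod]
    simp only [MvPolynomial.eval_X]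
    by_cases h0 : ∏ i ∈ Finset.univ.filter (fun i => Pi.single i 1 ∉ W), p (Sum.inl i) = 0
    · rw [h0, zero_mul]
    · rw [mem_stratumIdeal.1 (hf (Finset.univ.filter fun i => p (Sum.inl i) ≠ 0) ?_) p hp (by simp),
        mul_zero]
      intro i hi
      simpa using Finset.prod_ne_zero_iff.1 h0 i (by simpa using hi)
  have strip : ∀ s : Finset (Fin n), (∀ i ∈ s, Pi.single i 1 ∉ W) →
      (∏ i ∈ s, MvPolynomial.X (Sum.inl i)) * f ∈ quadIdeal W → f ∈ quadIdeal W := by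
    intro s
    induction s using Finset.induction_on with
    | empty => simp
    | insert a s ha ih =>
      intro hs h
      rw [Finset.prod_insert ha, mul_assoc] at h
      exact ih (fun i hi => hs i (Finset.mem_insert_of_mem hi))
        (X_mul_mem_quadIdeal W (hs a (Finset.mem_insert_self a s)) h)
  exact strip _ (by simp) key

/-- The ideals of different strata are incomparable. -/
theorem eq_of_stratumIdeal_le {I I' : Finset (Fin n)}
    (hI' : ∀ i, Pi.single i 1 ∉ W → i ∈ I') (h : stratumIdeal W I ≤ stratumIdeal W I') :
    I = I' := by
  classical
  -- Test points: `x` is the indicator of `I` and `y` is supported off `I`, so every product `x_i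
  -- y_i` is zero.
  have hpt : ∀ (I : Finset (Fin n)) (c : Fin n → K), (∀ i ∈ I, c i = 0) →
      Sum.elim (fun i => if i ∈ I then (1 : K) else 0) c ∈ nullPoints W := by
    intro I c hc w hw
    refine Finset.sum_eq_zero fun i _ => ?_
    by_cases hi : i ∈ I
    · simp [hc i hi]
    · simp [hi]
  ext i
  constructor
  · intro hi
    by_contra hi'
    have hiW : Pi.single i 1 ∈ W := by
      by_contra hW
      exact hi' (hI' i hW)
    -- For `i ∈ I \ I'` one has `e_i ∈ W`, so `x_i y_i = 0` forces `y_i = 0` over `J_I`, while `y_i`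
    -- is free over `J_I'`.
    have h1 : (MvPolynomial.X (Sum.inr i) : MvPolynomial (Fin n ⊕ Fin n) K) ∈ stratumIdeal W I := by
      rw [mem_stratumIdeal]
      intro p hp hpI
      have := hp _ hiW
      rw [Finset.sum_eq_single i (by intro j _ hj; simp [hj]) (by simp)] at this
      simpa [(hpI i).2 hi] using this
    have h2 := mem_stratumIdeal.1 (h h1) _ (hpt I' (Pi.single i 1) (by
      intro j hj
      have : j ≠ i := fun e => hi' (e ▸ hj)
      simp [this])) (by simp)
    simp at h2
  · intro hi'
    by_contra hi
    have h1 : (MvPolynomial.X (Sum.inl i) : MvPolynomial (Fin n ⊕ Fin n) K) ∈ stratumIdeal W I := by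
      rw [mem_stratumIdeal]
      intro p hp hpI
      simpa using mt (hpI i).1 hi
    have h2 := mem_stratumIdeal.1 (h h1) _ (hpt I' 0 (by simp)) (by simp)
    simp [hi'] at h2

/-- The finite intersection of the admissible stratum ideals lies in `quadIdeal W`, so a prime above
the latter contains one of them; incomparability makes each of them minimal. -/
theorem minimalPrimes_quadIdeal [IsAlgClosed K] :
    (quadIdeal W).minimalPrimes =
      {P | ∃ I : Finset (Fin n), (∀ i, Pi.single i 1 ∉ W → i ∈ I) ∧ P = stratumIdeal W I} := by
  classical
  have : Infinite K := IsAlgClosed.instInfinite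
  have hle : ∀ Q : Ideal (MvPolynomial (Fin n ⊕ Fin n) K), Q.IsPrime → quadIdeal W ≤ Q →
      ∃ I : Finset (Fin n), (∀ i, Pi.single i 1 ∉ W → i ∈ I) ∧ stratumIdeal W I ≤ Q := by
    intro Q hQ h
    have h1 : (Finset.univ.filter fun I : Finset (Fin n) => ∀ i, Pi.single i 1 ∉ W → i ∈ I).inf
        (stratumIdeal W) ≤ Q := by
      refine le_trans (fun f hf => ?_) h
      refine mem_quadIdeal_of_forall_stratumIdeal fun I hI => ?_
      exact (Finset.inf_le (by simpa using hI) :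
        (Finset.univ.filter fun I : Finset (Fin n) => ∀ i, Pi.single i 1 ∉ W → i ∈ I).inf
        (stratumIdeal W) ≤ stratumIdeal W I) hf
    obtain ⟨I, hI, hIQ⟩ := hQ.inf_le'.1 h1
    exact ⟨I, by simpa using hI, hIQ⟩
  ext P
  constructor
  · rintro ⟨⟨hP, hPq⟩, hmin⟩
    obtain ⟨I, hI, hIP⟩ := hle P hP hPq
    exact ⟨I, hI, le_antisymm
      (hmin ⟨isPrime_stratumIdeal hI, quadIdeal_le_stratumIdeal I⟩ hIP) hIP⟩
  · rintro ⟨I, hI, rfl⟩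
    refine ⟨⟨isPrime_stratumIdeal hI, quadIdeal_le_stratumIdeal I⟩, fun Q hQ hQI => ?_⟩
    obtain ⟨I', hI', h⟩ := hle Q hQ.1 hQ.2
    rwa [← eq_of_stratumIdeal_le hI (h.trans hQI)]

end TorusNullFiber

/-! ### Complete intersection, irreducibility and normality. -/

namespace TorusNullFiber

section ideal

variable {K : Type*} [Field K] {n : ℕ} {W : Submodule K (Fin n → K)}

theorem isCompleteIntersectionIdeal_quadIdeal : IsCompleteIntersectionIdeal (quadIdeal W) := by
  let c := Module.finBasis K W
  refine ⟨Module.finrank K W, fun k => quad (c k), le_antisymm ?_ ?_, ?_⟩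
  · refine Ideal.span_le.2 ?_
    rintro _ ⟨w, hw, rfl⟩
    have h := congrArg (fun v : W => quad (v : Fin n → K)) (c.sum_repr ⟨w, hw⟩)
    simp only [AddSubmonoidClass.coe_finsetSum, Submodule.coe_smul, map_sum, map_smul] at h
    rw [← h]
    refine Ideal.sum_mem _ fun k _ => ?_
    rw [MvPolynomial.smul_eq_C_mul]
    exact Ideal.mul_mem_left _ _ (Ideal.subset_span ⟨k, rfl⟩)
  · refine Ideal.span_le.2 ?_
    rintro _ ⟨k, rfl⟩
    exact Ideal.subset_span ⟨_, (c k).2, rfl⟩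
  · rw [ringKrullDim_quot]
    simp [two_mul]

/-- The coordinate axes lie in the zero fibre. -/
theorem eval_zero_of_mul_X_mem_quadIdeal {f : MvPolynomial (Fin n ⊕ Fin n) K} {s : Fin n ⊕ Fin n}
    (h : f * MvPolynomial.X s ∈ quadIdeal W) : MvPolynomial.eval 0 f = 0 := by
  classical
  -- Restriction to the axis of the variable `s`, with values in a domain where `X s` is nonzero; so
  -- `f` vanishes on the axis, in particular at the origin.
  let θ : MvPolynomial (Fin n ⊕ Fin n) K →ₐ[K] Polynomial K :=
    MvPolynomial.aeval (Pi.single s Polynomial.X)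
  have hθ : quadIdeal W ≤ RingHom.ker θ := by
    refine Ideal.span_le.2 ?_
    rintro _ ⟨w, -, rfl⟩
    rw [SetLike.mem_coe, RingHom.mem_ker, quad_apply, map_sum]
    refine Finset.sum_eq_zero fun i _ => ?_
    rcases s with j | j <;> simp [θ]
  have h1 := hθ h
  rw [RingHom.mem_ker, map_mul] at h1
  have h2 : θ f = 0 := (mul_eq_zero.1 h1).resolve_right (by simp [θ])
  have h3 : (Polynomial.evalRingHom 0).comp θ.toRingHom = MvPolynomial.eval 0 := by
    refine MvPolynomial.ringHom_ext (fun a => by simp [θ]) fun s' => ?_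
    rcases eq_or_ne s' s with rfl | hs
    · simp [θ]
    · simp [θ, hs]
  rw [← h3]
  simp [h2]

theorem X_mul_X_mem_quadIdeal {i : Fin n} (hi : Pi.single i 1 ∈ W) :
    (MvPolynomial.X (Sum.inl i) * MvPolynomial.X (Sum.inr i) : MvPolynomial (Fin n ⊕ Fin n) K) ∈
      quadIdeal W :=
  Ideal.subset_span ⟨_, hi, by simp [quad]⟩

theorem irreducibleSpace_quot_iff :
    IrreducibleSpace (PrimeSpectrum (MvPolynomial (Fin n ⊕ Fin n) K ⧸ quadIdeal W)) ↔
      ∀ i, Pi.single i 1 ∉ W := by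
  constructor
  · intro h i hi
    rw [PrimeSpectrum.irreducibleSpace_iff_isPrime_nilradical] at h
    have hred := isReduced_quot W
    rw [nilradical_eq_zero, Ideal.zero_eq_bot] at h
    have h0 : ∀ s, Ideal.Quotient.mk (quadIdeal W) (MvPolynomial.X s) ∉
        (⊥ : Ideal (MvPolynomial (Fin n ⊕ Fin n) K ⧸ quadIdeal W)) := by
      intro s hs
      rw [Ideal.mem_bot, Ideal.Quotient.eq_zero_iff_mem] at hs
      have := eval_zero_of_mul_X_mem_quadIdeal (f := 1) (s := s) (by rwa [one_mul])
      simp at this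
    have h1 : Ideal.Quotient.mk (quadIdeal W) (MvPolynomial.X (Sum.inl i)) *
        Ideal.Quotient.mk (quadIdeal W) (MvPolynomial.X (Sum.inr i)) ∈
        (⊥ : Ideal (MvPolynomial (Fin n ⊕ Fin n) K ⧸ quadIdeal W)) := by
      rw [← map_mul, Ideal.mem_bot, Ideal.Quotient.eq_zero_iff_mem]
      exact X_mul_X_mem_quadIdeal hi
    exact (h.mem_or_mem h1).elim (h0 _) (h0 _)
  · intro h
    have := (isDomain_and_isIntegrallyClosed_quot W h).1
    infer_instance

theorem isNormalRing_of_isIntegrallyClosed (R : Type*) [CommRing R] [IsDomain R]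
    [IsIntegrallyClosed R] : IsNormalRing R := by
  intro P _
  exact ⟨IsLocalization.isDomain_of_le_nonZeroDivisors (M := P.primeCompl) _
    P.primeCompl_le_nonZeroDivisors, isIntegrallyClosed_of_isLocalization _ P.primeCompl
    P.primeCompl_le_nonZeroDivisors⟩

/-- If `e_i ∈ W`, the local ring at the origin is not a domain: `x_i y_i = 0`, and neither variable
is killed by a function that is nonzero at the origin. -/
theorem isNormalRing_quot_iff :
    IsNormalRing (MvPolynomial (Fin n ⊕ Fin n) K ⧸ quadIdeal W) ↔ ∀ i, Pi.single i 1 ∉ W := by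
  constructor
  · intro h i hi
    let ε : (MvPolynomial (Fin n ⊕ Fin n) K ⧸ quadIdeal W) →+* K :=
      Ideal.Quotient.lift _ (MvPolynomial.eval 0) ((mem_nullPoints_iff W 0).1 (by
        intro w _
        simp))
    have hε : ∀ f, ε (Ideal.Quotient.mk _ f) = MvPolynomial.eval 0 f := fun f => rfl
    have hprime : (RingHom.ker ε).IsPrime := RingHom.ker_isPrime ε
    have hdom := (h (RingHom.ker ε)).1
    have h0 : ∀ s, algebraMap _ (Localization.AtPrime (RingHom.ker ε))
        (Ideal.Quotient.mk (quadIdeal W) (MvPolynomial.X s)) ≠ 0 := by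
      intro s hs
      obtain ⟨⟨c, hc⟩, hcs⟩ := (IsLocalization.map_eq_zero_iff (RingHom.ker ε).primeCompl _ _).1 hs
      obtain ⟨f, rfl⟩ := Ideal.Quotient.mk_surjective c
      rw [← map_mul, Ideal.Quotient.eq_zero_iff_mem] at hcs
      exact hc (eval_zero_of_mul_X_mem_quadIdeal hcs)
    refine mul_ne_zero (h0 (Sum.inl i)) (h0 (Sum.inr i)) ?_
    rw [← map_mul, ← map_mul, Ideal.Quotient.eq_zero_iff_mem.2 (X_mul_X_mem_quadIdeal hi), map_zero]
  · intro h
    obtain ⟨h1, h2⟩ := isDomain_and_isIntegrallyClosed_quot W h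
    exact isNormalRing_of_isIntegrallyClosed _

end ideal

/-! ### Irreducible components of the scheme. -/

section components

variable {K A V : Type*} [Field K] [CommRing A] [HopfAlgebra K A] [AddCommGroup V] [Module K V]
  {n r : ℕ} {e : A ≃ₐc[K] AddMonoidAlgebra K (Fin r → ℤ)} {ρ : RationalRep K A V}
  {b : Module.Basis (Fin n) K V} {S : Matrix (Fin n) (Fin r) ℤ}

theorem momentMap_eq_zero_iff (hS : ρ.IsWeightBasis e b S) (p : V × Module.Dual K V) :
    ρ.momentMap p = 0 ↔ RationalRep.coords b p ∈ nullPoints (colSpace K S) := by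
  rw [mem_nullPoints_iff, ← nullIdeal_eq hS]
  constructor
  · intro h f hf
    refine (Ideal.span_le (I := RingHom.ker (MvPolynomial.eval (RationalRep.coords b p)))).2 ?_ hf
    rintro _ ⟨D, rfl⟩
    rw [SetLike.mem_coe, RingHom.mem_ker, RationalRep.eval_momentPoly, h]
    rfl
  · intro h
    ext D
    rw [← ρ.eval_momentPoly b]
    exact h _ (Ideal.subset_span ⟨D, rfl⟩)

theorem exists_coords_eq (b : Module.Basis (Fin n) K V) (q : Fin n ⊕ Fin n → K) :
    ∃ p, RationalRep.coords b p = q := by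
  refine ⟨(b.equivFun.symm fun i => q (Sum.inl i), b.constr K fun i => q (Sum.inr i)), ?_⟩
  funext s
  rcases s with i | i
  · simp only [RationalRep.coords, Sum.elim_inl]
    rw [← b.equivFun_apply, LinearEquiv.apply_symm_apply]
  · simp only [RationalRep.coords, Sum.elim_inr]
    exact b.constr_basis K _ i

/-- Coordinates identify the pairs `(x, φ)` of the fibre with `nullPoints`, so both ideals test
vanishing at the same points. -/
theorem comap_vanishingIdeal_nullOver (hS : ρ.IsWeightBasis e b S) (I : Finset (Fin n)) :
    (PrimeSpectrum.vanishingIdeal (ρ.nullOver b (RationalRep.stratum b I))).comap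
      (Ideal.Quotient.mk (ρ.nullIdeal b)) = stratumIdeal (colSpace K S) I := by
  ext f
  rw [Ideal.mem_comap, PrimeSpectrum.mem_vanishingIdeal, mem_stratumIdeal]
  constructor
  · intro h q hq hqI
    obtain ⟨p, rfl⟩ := exists_coords_eq b q
    exact h _ ⟨⟨p, (momentMap_eq_zero_iff hS p).2 hq⟩, hqI, rfl⟩
  · rintro h _ ⟨⟨p, hp⟩, hpI, rfl⟩
    exact h _ ((momentMap_eq_zero_iff hS p).1 hp) hpI

/-- Components are zero loci of minimal primes, which can be compared after pullback to the
polynomial ring; the zero locus of a vanishing ideal is the closure. -/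
theorem irreducibleComponents_nullFiber [IsAlgClosed K] (hS : ρ.IsWeightBasis e b S) :
    irreducibleComponents (ρ.NullFiber b) = {Z | ∃ I : Finset (Fin n),
      (∀ i, Pi.single i 1 ∉ colSpace K S → i ∈ I) ∧
        Z = closure (ρ.nullOver b (RationalRep.stratum b I))} := by
  have hmin : minimalPrimes (ρ.NullRing b) = {P | ∃ I : Finset (Fin n),
      (∀ i, Pi.single i 1 ∉ colSpace K S → i ∈ I) ∧
        P = PrimeSpectrum.vanishingIdeal (ρ.nullOver b (RationalRep.stratum b I))} := by
    have hinj := Ideal.comap_injective_of_surjective (Ideal.Quotient.mk (ρ.nullIdeal b))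
      Ideal.Quotient.mk_surjective
    apply Set.image_injective.2 hinj
    rw [← Ideal.minimalPrimes_eq_comap]
    refine ((congrArg Ideal.minimalPrimes (nullIdeal_eq hS)).trans minimalPrimes_quadIdeal).trans ?_
    ext P
    constructor
    · rintro ⟨I, hI, rfl⟩
      exact ⟨_, ⟨I, hI, rfl⟩, comap_vanishingIdeal_nullOver hS I⟩
    · rintro ⟨_, ⟨I, hI, rfl⟩, rfl⟩
      exact ⟨I, hI, comap_vanishingIdeal_nullOver hS I⟩
  rw [← PrimeSpectrum.zeroLocus_minimalPrimes, hmin]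
  ext Z
  constructor
  · rintro ⟨_, ⟨I, hI, rfl⟩, rfl⟩
    exact ⟨I, hI, PrimeSpectrum.zeroLocus_vanishingIdeal_eq_closure _⟩
  · rintro ⟨I, hI, rfl⟩
    exact ⟨_, ⟨I, hI, rfl⟩, PrimeSpectrum.zeroLocus_vanishingIdeal_eq_closure _⟩

end components

end TorusNullFiber

open TorusNullFiber in
theorem mainTheorem2 {K : Type*} [Field K] [IsAlgClosed K] [CharZero K]
    {A : Type*} [CommRing A] [HopfAlgebra K A] {r : ℕ}
    (e : A ≃ₐc[K] AddMonoidAlgebra K (Fin r → ℤ))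
    {V : Type*} [AddCommGroup V] [Module K V] (ρ : RationalRep K A V)
    {n : ℕ} (b : Module.Basis (Fin n) K V) (S : Matrix (Fin n) (Fin r) ℤ)
    (hS : ρ.IsWeightBasis e b S) :
    (IsReduced (ρ.NullRing b) ∧
      IsCompleteIntersectionIdeal (ρ.nullIdeal b) ∧
      ringKrullDim (ρ.NullRing b) + (rowRank K S Finset.univ : WithBot ℕ∞) =
        ((2 * Module.finrank K V : ℕ) : WithBot ℕ∞)) ∧
    (irreducibleComponents (ρ.NullFiber b) =
      {Z | ∃ I : Finset (Fin n),
        (rowRank K S Finset.univ : ℤ) - rowRank K S I = n - I.card ∧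
        Z = closure (ρ.nullOver b (RationalRep.stratum b I))}) ∧
    (IrreducibleSpace (ρ.NullFiber b) ↔
      ∀ i : Fin n, rowRank K S (Finset.univ.erase i) = rowRank K S Finset.univ) ∧
    (IsNormalRing (ρ.NullRing b) ↔ IrreducibleSpace (ρ.NullFiber b)) := by
  have hfin : Module.finrank K V = n := by
    rw [Module.finrank_eq_card_basis b, Fintype.card_fin]
  refine ⟨?_, ?_, ?_⟩
  · unfold RationalRep.NullRing
    rw [nullIdeal_eq hS, rowRank_univ, hfin]
    exact ⟨isReduced_quot _, isCompleteIntersectionIdeal_quadIdeal, ringKrullDim_quot _⟩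
  · simp only [rowRank_sub_eq_iff]
    exact irreducibleComponents_nullFiber hS
  · simp only [rowRank_erase_eq_iff]
    unfold RationalRep.NullFiber RationalRep.NullRing
    rw [nullIdeal_eq hS]
    exact ⟨irreducibleSpace_quot_iff, isNormalRing_quot_iff.trans irreducibleSpace_quot_iff.symm⟩
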